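/- **Setting.** Let $O=(L,Z,A,Y)\sim P$, where $A$ and $Y$ are real-valued. Write $P_L,P_A,P_{A,L}$ for the marginal laws. Assume that $P_{A,L}$ has a density $p_{A|L}(a\mid l)$ with respect to $da\otimes P_L(dl)$ (a conditional density of $A$ given $L$), that $p_{A|L}>0$ holds $P_A\otimes P_L$-almost everywhere, and that $E|Y|<\infty$. Let $p_A$ be the marginal density of $A$. For a measurable $\pi(z,l)$ put $Z_\pi=\pi(Z,L)$ and $$\rho_\pi^o(L)=E[Z_\pi\mid L],\quad \kappa_\pi^o(A,L)=E[Z_\pi\mid A,L]-E[Z_\pi\mid L],\quad \eta^o(A,L)=E[Y\mid A,L],\quad \delta^o(A,L)=\frac{p_A(A)}{p_{A|L}(A\mid L)},$$ $$\mu_\pi^o(A,L)=\frac{E[YZ_\pi\mid A,L]-E[Y\mid A,L]\,E[Z_\pi\mid L]}{E[Z_\pi\mid A,L]-E[Z_\pi\mid L]} .$$ The function $\pi$ is a *uniform regular weighting function* (URWF) for a subset $N$ of the interior of the support of $A$ if $\pi$ is bounded and there is $\epsilon>0$ such that, for ($P_A$-almost) all $a\in N$, $|\kappa_\pi^o(a,L)|\ge\epsilon$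 almost surely. **Efficient influence function.** A *regular submodel* through $P$ is a path $t\mapsto P_t$ of probability laws of $O$ with $P_0=P$ that satisfies the following for $t$ near $0$: - the likelihood ratios $dP_t/dP$ are bounded, and bounded away from $0$, uniformly in $t$; - the lower bound on $|\kappa_\pi|$ over $\{q\neq0\}$ in the definition of a URWF holds under $P_t$ with an $\epsilon$ that does not depend on $t$. It has score $s\in L^2(P)$ if it is differentiable in quadratic mean at $t=0$ with score $s$. The *tangent space* is the closed linear span of these scores in $L^2(P)$. The *efficient influence function* (EIF) of a functional $\psi$ at $P$ is the mean-zero $\varphi\in L^2(P)$ that lies in the tangent space and satisfies $\frac{d}{dt}\psi(P_t)\big|_{t=0}=E_P[\varphi s]$ for every regular submodel with score $s$. **Theorem.** Let $q:\mathbb R\to\mathbb R$ be measurable, let $\pi$ be a URWF for the support $\{q\ne 0\}$ of $q$, and suppose that $E[(\delta^o(A,L)q(A)Y)^2]<\infty$. Then $$\psi_{\pi,q}^o=\int\!\!\int \mu_\pi^o(a,l)\,q(a)\,dP_L(l)\,dP_A(a)$$ is well defined (the integrand is $P_A\otimes P_L$-integrable), the model is nonparametric (the tangent space contains every mean-zero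 function in $L^2(P)$), and the EIF of $\psi_{\pi,q}$ at $P$ is $$\begin{aligned}&(Z_\pi-\rho_\pi^o(L))\left\{\delta^o(A,L)\,\frac{Y-\mu_\pi^o(A,L)}{\kappa_\pi^o(A,L)}\,q(A)-\int\frac{\eta^o(a,L)-\mu_\pi^o(a,L)}{\kappa_\pi^o(a,L)}\,q(a)\,dP_A(a)\right\}\\&\quad+q(A)\int\mu_\pi^o(A,l)\,dP_L(l)+\int\mu_\pi^o(a,L)\,q(a)\,dP_A(a)-2\psi_{\pi,q}^o .\end{aligned}$$ -/

import Mathlib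

open MeasureTheory ProbabilityTheory Filter Topology
open scoped NNReal ENNReal

namespace CovariateShift

noncomputable section

/-! ## Efficient influence functions -/

section Efficiency

variable {Ω : Type*} [MeasurableSpace Ω]

/-- A one-parameter submodel `t ↦ Q t`, dominated by `Q 0`, is differentiable in quadratic mean
at `t = 0` with score `s`: writing `p_t = dQ_t / dQ_0`,
`∫ (√p_t - 1 - (t / 2) s)² dQ_0 = o(t²)` as `t → 0`. -/
def HasScore (Q : ℝ → ProbabilityMeasure Ω) (s : Ω → ℝ) : Prop :=
  MemLp s 2 (Q 0 : Measure Ω) ∧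
  (∀ᶠ t in 𝓝 (0 : ℝ), (Q t : Measure Ω) ≪ (Q 0 : Measure Ω)) ∧
  Tendsto (fun t : ℝ =>
      (∫ o, (√(((Q t : Measure Ω).rnDeriv (Q 0 : Measure Ω) o).toReal) - 1 - t / 2 * s o) ^ 2
        ∂(Q 0 : Measure Ω)) / t ^ 2)
    (𝓝[≠] 0) (𝓝 0)

/-- The tangent space at `P` of a collection `R` of one-parameter submodels: the closed linear span
in `L²(P)` of the scores of all members of `R` that pass through `P` at `t = 0`. -/
def tangentSpace (R : Set (ℝ → ProbabilityMeasure Ω)) (P : ProbabilityMeasure Ω) :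
    Submodule ℝ (Lp ℝ 2 (P : Measure Ω)) :=
  (Submodule.span ℝ
    {g : Lp ℝ 2 (P : Measure Ω) | ∃ Q ∈ R, Q 0 = P ∧ HasScore Q (g : Ω → ℝ)}).topologicalClosure

/-- `φ` is the efficient influence function (canonical gradient) at `P` of the functional `ψ`,
relative to the collection `R` of one-parameter submodels: it has mean zero and finite variance,
represents the derivative of `ψ` along every submodel as the inner product with the score, and
belongs to the tangent space. -/
structure IsEIF (R : Set (ℝ → ProbabilityMeasure Ω)) (ψ : ProbabilityMeasure Ω → ℝ)
    (P : ProbabilityMeasure Ω) (φ : Ω → ℝ) : Prop where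
  memLp : MemLp φ 2 (P : Measure Ω)
  mean_zero : ∫ o, φ o ∂(P : Measure Ω) = 0
  hasDerivAt : ∀ Q ∈ R, Q 0 = P → ∀ s : Ω → ℝ, HasScore Q s →
    HasDerivAt (fun t : ℝ => ψ (Q t)) (∫ o, φ o * s o ∂(P : Measure Ω)) 0
  mem_tangentSpace : memLp.toLp φ ∈ tangentSpace R P

/-- The regression function `w ↦ E_P[f | W = w]`, computed from the conditional law of `f`
given `W`. -/
def regression {β : Type*} [MeasurableSpace β] (P : ProbabilityMeasure Ω) (f : Ω → ℝ) (W : Ω → β)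
    (w : β) : ℝ :=
  ∫ x, x ∂(condDistrib f W (P : Measure Ω) w)

end Efficiency

/-! ## The observed data `O = (L, Z, A, Y)` -/

/-- Values of the observed data: covariates `L`, instruments `Z`, real treatment `A`, real
outcome `Y`, in this order. -/
abbrev Obs (𝓛 𝓩 : Type*) : Type _ := 𝓛 × 𝓩 × ℝ × ℝ

section Observed

variable {𝓛 𝓩 : Type*} [MeasurableSpace 𝓛] [MeasurableSpace 𝓩]

/-- The covariates. -/
def obsL (o : Obs 𝓛 𝓩) : 𝓛 := o.1

/-- The instruments. -/
def obsZ (o : Obs 𝓛 𝓩) : 𝓩 := o.2.1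

/-- The treatment. -/
def obsA (o : Obs 𝓛 𝓩) : ℝ := o.2.2.1

/-- The outcome. -/
def obsY (o : Obs 𝓛 𝓩) : ℝ := o.2.2.2

/-- The pair `(A, L)`. -/
def obsAL (o : Obs 𝓛 𝓩) : ℝ × 𝓛 := (obsA o, obsL o)

/-- The weighted instrument `Z_π = π(Z, L)`. -/
def obsZpi (π : 𝓩 × 𝓛 → ℝ) (o : Obs 𝓛 𝓩) : ℝ := π (obsZ o, obsL o)

/-- The marginal law `P_L`. -/
def lawL (P : ProbabilityMeasure (Obs 𝓛 𝓩)) : Measure 𝓛 := (P : Measure (Obs 𝓛 𝓩)).map obsL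

/-- The marginal law `P_A`. -/
def lawA (P : ProbabilityMeasure (Obs 𝓛 𝓩)) : Measure ℝ := (P : Measure (Obs 𝓛 𝓩)).map obsA

/-- The joint law `P_{A,L}`. -/
def lawAL (P : ProbabilityMeasure (Obs 𝓛 𝓩)) : Measure (ℝ × 𝓛) :=
  (P : Measure (Obs 𝓛 𝓩)).map obsAL

/-- The marginal density `p_A(a)` with respect to Lebesgue measure. -/
def densA (P : ProbabilityMeasure (Obs 𝓛 𝓩)) (a : ℝ) : ℝ :=
  ((lawA P).rnDeriv volume a).toReal

/-- The conditional density `p_{A|L}(a | l)` with respect to Lebesgue measure, as a jointly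
measurable function of `(a, l)`: the density of `P_{A,L}` with respect to `da ⊗ P_L(dl)`. -/
def densAgivenL (P : ProbabilityMeasure (Obs 𝓛 𝓩)) (a : ℝ) (l : 𝓛) : ℝ :=
  ((lawAL P).rnDeriv (volume.prod (lawL P)) (a, l)).toReal

/-- `δ(a, l) = p_A(a) / p_{A|L}(a | l)`. -/
def deltaFn (P : ProbabilityMeasure (Obs 𝓛 𝓩)) (a : ℝ) (l : 𝓛) : ℝ :=
  densA P a / densAgivenL P a l

/-- `ρ_π(l) = E[Z_π | L = l]`. -/
def rhoFn (P : ProbabilityMeasure (Obs 𝓛 𝓩)) (π : 𝓩 × 𝓛 → ℝ) (l : 𝓛) : ℝ :=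
  regression P (obsZpi π) obsL l

/-- `κ_π(a, l) = E[Z_π | A = a, L = l] - E[Z_π | L = l]`. -/
def kappaFn (P : ProbabilityMeasure (Obs 𝓛 𝓩)) (π : 𝓩 × 𝓛 → ℝ) (a : ℝ) (l : 𝓛) : ℝ :=
  regression P (obsZpi π) obsAL (a, l) - regression P (obsZpi π) obsL l

/-- `η(a, l) = E[Y | A = a, L = l]`. -/
def etaFn (P : ProbabilityMeasure (Obs 𝓛 𝓩)) (a : ℝ) (l : 𝓛) : ℝ :=
  regression P obsY obsAL (a, l)

/-- `μ_π(a, l)`, the ratio of `E[Y Z_π | A = a, L = l] - E[Y | A = a, L = l] E[Z_π | L = l]`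
and `E[Z_π | A = a, L = l] - E[Z_π | L = l]`. -/
def muFn (P : ProbabilityMeasure (Obs 𝓛 𝓩)) (π : 𝓩 × 𝓛 → ℝ) (a : ℝ) (l : 𝓛) : ℝ :=
  (regression P (fun o => obsY o * obsZpi π o) obsAL (a, l)
      - regression P obsY obsAL (a, l) * regression P (obsZpi π) obsL l) /
    (regression P (obsZpi π) obsAL (a, l) - regression P (obsZpi π) obsL l)

/-- The estimand `ψ_{π,q}(P) = ∫ ∫ μ_π(a, l) q(a) dP_L(l) dP_A(a)`. -/
def psiFn (π : 𝓩 × 𝓛 → ℝ) (q : ℝ → ℝ) (P : ProbabilityMeasure (Obs 𝓛 𝓩)) : ℝ :=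
  ∫ a, ∫ l, muFn P π a l * q a ∂(lawL P) ∂(lawA P)

/-- `|κ_π(a, L)| ≥ ε` almost surely, for (almost) all `a ∈ N`. As `κ_π` is a conditional
expectation, it is determined only up to null sets of values of the treatment. -/
def KappaBoundedBelow (P : ProbabilityMeasure (Obs 𝓛 𝓩)) (π : 𝓩 × 𝓛 → ℝ) (N : Set ℝ)
    (ε : ℝ) : Prop :=
  ∀ᵐ a ∂(lawA P), a ∈ N → ∀ᵐ l ∂(lawL P), ε ≤ |kappaFn P π a l|

/-- `π` is a uniform regular weighting function for the subset `N` of the interior of the support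
of `A`. -/
structure IsURWF (P : ProbabilityMeasure (Obs 𝓛 𝓩)) (π : 𝓩 × 𝓛 → ℝ) (N : Set ℝ) : Prop where
  subset_interior : N ⊆ interior (lawA P).support
  measurable : Measurable π
  bounded : ∃ B : ℝ, ∀ x, |π x| ≤ B
  relevant : ∃ ε : ℝ, 0 < ε ∧ KappaBoundedBelow P π N ε

/-- The regular one-parameter submodels of the nonparametric model. No structure at all is imposed
on the laws `Q t`; the likelihood ratios with respect to `Q 0` are bounded above and away from zero,
and `π` stays a uniform regular weighting function for `N` near `t = 0`, with a common constant.
Both are local to `t = 0`. -/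
def regularSubmodels (π : 𝓩 × 𝓛 → ℝ) (N : Set ℝ) : Set (ℝ → ProbabilityMeasure (Obs 𝓛 𝓩)) :=
  {Q | (∃ K : ℝ≥0, ∀ᶠ t in 𝓝 (0 : ℝ),
          (Q t : Measure (Obs 𝓛 𝓩)) ≤ K • (Q 0 : Measure (Obs 𝓛 𝓩)) ∧
          (Q 0 : Measure (Obs 𝓛 𝓩)) ≤ K • (Q t : Measure (Obs 𝓛 𝓩))) ∧
       (∃ ε : ℝ, 0 < ε ∧ ∀ᶠ t in 𝓝 (0 : ℝ), KappaBoundedBelow (Q t) π N ε)}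

/-- The influence function
`δ(A,L) (Z_π - ρ_π(L)) (Y - μ_π(A,L)) / κ_π(A,L) q(A)
  - (Z_π - ρ_π(L)) ∫ (η(a,L) - μ_π(a,L)) / κ_π(a,L) q(a) dP_A(a)
  + q(A) ∫ μ_π(A,l) dP_L(l) + ∫ μ_π(a,L) q(a) dP_A(a) - 2 ψ_{π,q}`. -/
def eifFn (P : ProbabilityMeasure (Obs 𝓛 𝓩)) (π : 𝓩 × 𝓛 → ℝ) (q : ℝ → ℝ) (o : Obs 𝓛 𝓩) : ℝ :=
  (obsZpi π o - rhoFn P π (obsL o)) *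
      (deltaFn P (obsA o) (obsL o) *
          ((obsY o - muFn P π (obsA o) (obsL o)) / kappaFn P π (obsA o) (obsL o) * q (obsA o))
        - ∫ a, (etaFn P a (obsL o) - muFn P π a (obsL o)) / kappaFn P π a (obsL o) * q a
            ∂(lawA P))
    + q (obsA o) * (∫ l, muFn P π (obsA o) l ∂(lawL P))
    + (∫ a, muFn P π a (obsL o) * q a ∂(lawA P))
    - 2 * psiFn π q P

end Observed

end

end CovariateShift

/-! Let `dQ = p dP`, and write `b = E[p | A]`, `c = E[p | L]`, `e = E[p | A, L]`, all under `P`.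
Positivity of the conditional density makes `δ(A, L)` the density of `P_A ⊗ P_L` with respect to
`P_{A,L}`, so the product of the `Q`-marginals has density `δ b c`. The ratio defining `μ` is linear
in the outcome and commutes with `(A, L)`-measurable weights. Replacing `Y` by `δ q Y`, which lies
in `L²`, therefore gives `ψ(Q) = E[μ_p b c]`, where `μ_p` is the ratio for the new outcome under `Q`
(`psiFn_eq_weightedPsi`). Everything is then expressed by conditional expectations under the single
law `P`.

The baseline ratio is characterised by a moment condition: the residual `V = Y - μ` satisfies `E[V
(Z - ρ) | A, L] = 0`. Comparison with its analogue under `Q` gives the exact identity `κ_p e (μ_p -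
μ) = E[V (Z - ρ)(p - 1) | A, L] - (ρ_p - ρ) E[V p | A, L]`, where `ρ_p - ρ = E[(Z - ρ)(p - 1) | L] /
c` (`condMu_sub`). Telescoping `μ_p b c - μ` and moving each conditional expectation off `p - 1` by
self-adjointness yields `ψ(Q) - ψ(P) = E[D_p (p - 1)]` without remainder; all nonlinearity sits in
`D_p`, which is `gradAt` (`weightedPsi_sub`).

Along a path differentiable in quadratic mean with bounded likelihood ratios, `(p_t - 1) / t` tends
to the score in `L²` (`exists_seq_tendsto_score`), and `D_{p_t}` tends to `D_1` in `L²`, being built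
from bounded multipliers of fixed `L²` functions (`gradAt_tendsto`). Both limits hold along
subsequences, which suffices for the derivative `E[D_1 s]`. Finally `D_1` is the claimed influence
function plus `2ψ` (`eifFn_ae_eq`); the constant is invisible to scores, which have mean zero, and
`E[D_1] = 2ψ` centres the influence function.

For the tangent space, a bounded mean-zero `g` is the score of the path `(1 + t g) P`. This path is
regular because `Z_π` is bounded, so `κ_π` moves by `O(t)` uniformly. Such `g` are dense among the
mean-zero functions in `L²`, so the tangent space contains them all, and in particular the influence
function. -/

namespace CovariateShift

set_option linter.unusedSectionVars false

/-! ## Convergence in `L²` -/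

section MeanSquare

variable {Ω : Type*} {m0 : MeasurableSpace Ω} {P : Measure Ω}

/-- Convergence in mean square of square-integrable functions. -/
structure TendstoMeanSquare {ι : Type*} (P : Measure Ω) (f : ι → Ω → ℝ) (l : Filter ι)
    (g : Ω → ℝ) : Prop where
  memLp : ∀ n, MemLp (f n) 2 P
  memLp_limit : MemLp g 2 P
  tendsto : Tendsto (fun n => eLpNorm (f n - g) 2 P) l (𝓝 0)

theorem eLpNorm_two_eq_ofReal_sqrt {f : Ω → ℝ} (hf : MemLp f 2 P) :
    eLpNorm f 2 P = ENNReal.ofReal (√(∫ ω, f ω ^ 2 ∂P)) := by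
  rw [hf.eLpNorm_eq_integral_rpow_norm (by norm_num) (by norm_num), Real.sqrt_eq_rpow]
  congr 2
  · simp
  · norm_num

theorem tendsto_eLpNorm_two_iff {ι : Type*} {l : Filter ι} {f : ι → Ω → ℝ}
    (hf : ∀ n, MemLp (f n) 2 P) :
    Tendsto (fun n => eLpNorm (f n) 2 P) l (𝓝 0) ↔
      Tendsto (fun n => ∫ ω, f n ω ^ 2 ∂P) l (𝓝 0) := by
  simp_rw [fun n => eLpNorm_two_eq_ofReal_sqrt (hf n)]
  constructor
  · intro h
    have h1 := (ENNReal.tendsto_toReal ENNReal.zero_ne_top).comp h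
    have h2 : Tendsto (fun n => √(∫ ω, f n ω ^ 2 ∂P)) l (𝓝 0) := by
      refine h1.congr fun n => ?_
      simp [ENNReal.toReal_ofReal (Real.sqrt_nonneg _)]
    have h3 := h2.pow 2
    simp only [ne_eq, OfNat.ofNat_ne_zero, not_false_eq_true, zero_pow] at h3
    refine h3.congr fun n => ?_
    exact Real.sq_sqrt (integral_nonneg fun _ => sq_nonneg _)
  · intro h
    have h1 := (ENNReal.continuous_ofReal.tendsto _).comp ((Real.continuous_sqrt.tendsto _).comp h)
    simpa [Function.comp_def] using h1

theorem TendstoMeanSquare.of_integral {ι : Type*} {l : Filter ι} {f : ι → Ω → ℝ} {g : Ω → ℝ}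
    (hf : ∀ n, MemLp (f n) 2 P) (hg : MemLp g 2 P)
    (h : Tendsto (fun n => ∫ ω, (f n ω - g ω) ^ 2 ∂P) l (𝓝 0)) : TendstoMeanSquare P f l g :=
  ⟨hf, hg, (tendsto_eLpNorm_two_iff fun n => (hf n).sub hg).2 h⟩

theorem TendstoMeanSquare.comp {ι κ : Type*} {l : Filter ι} {k : Filter κ} {f : ι → Ω → ℝ}
    {g : Ω → ℝ} (h : TendstoMeanSquare P f l g) {u : κ → ι} (hu : Tendsto u k l) :
    TendstoMeanSquare P (fun n => f (u n)) k g :=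
  ⟨fun _ => h.memLp _, h.memLp_limit, h.tendsto.comp hu⟩

theorem TendstoMeanSquare.congr {ι : Type*} {l : Filter ι} {f f' : ι → Ω → ℝ}
    {g g' : Ω → ℝ} (h : TendstoMeanSquare P f l g) (hf : ∀ n, f n =ᵐ[P] f' n) (hg : g =ᵐ[P] g') :
    TendstoMeanSquare P f' l g' :=
  ⟨fun n => (h.memLp n).ae_eq (hf n), h.memLp_limit.ae_eq hg,
    h.tendsto.congr fun n => eLpNorm_congr_ae ((hf n).sub hg)⟩

theorem TendstoMeanSquare.const {ι : Type*} {l : Filter ι} {g : Ω → ℝ} (hg : MemLp g 2 P) :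
    TendstoMeanSquare P (fun _ : ι => g) l g :=
  ⟨fun _ => hg, hg, by simp [tendsto_const_nhds]⟩

theorem TendstoMeanSquare.add {ι : Type*} {l : Filter ι} {f f' : ι → Ω → ℝ}
    {g g' : Ω → ℝ} (h : TendstoMeanSquare P f l g) (h' : TendstoMeanSquare P f' l g') :
    TendstoMeanSquare P (fun n => f n + f' n) l (g + g') := by
  refine ⟨fun n => (h.memLp n).add (h'.memLp n), h.memLp_limit.add h'.memLp_limit, ?_⟩
  refine tendsto_of_tendsto_of_tendsto_of_le_of_le tendsto_const_nhds
    (by simpa using h.tendsto.add h'.tendsto) (fun _ => zero_le) fun n => ?_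
  have : f n + f' n - (g + g') = (f n - g) + (f' n - g') := by abel
  rw [this]
  exact eLpNorm_add_le ((h.memLp n).sub h.memLp_limit).1 ((h'.memLp n).sub h'.memLp_limit).1
    (by norm_num)

theorem MemLp.bounded_mul {f g : Ω → ℝ} {C : ℝ} (hg : MemLp g 2 P)
    (hf : AEStronglyMeasurable f P) (hb : ∀ᵐ ω ∂P, |f ω| ≤ C) :
    MemLp (fun ω => f ω * g ω) 2 P := by
  refine hg.of_le_mul (c := C) (hf.mul hg.1) ?_
  filter_upwards [hb] with ω h
  rw [norm_mul]
  exact mul_le_mul_of_nonneg_right h (norm_nonneg _)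

/-- Multiplication by a uniformly bounded function preserves mean square convergence to zero. -/
theorem TendstoMeanSquare.bounded_mul_zero {ι : Type*} {l : Filter ι} {u f : ι → Ω → ℝ} {C : ℝ}
    (h : TendstoMeanSquare P f l 0) (hu : ∀ n, AEStronglyMeasurable (u n) P)
    (hb : ∀ n, ∀ᵐ ω ∂P, |u n ω| ≤ C) :
    TendstoMeanSquare P (fun n ω => u n ω * f n ω) l 0 := by
  refine ⟨fun n => MemLp.bounded_mul (h.memLp n) (hu n) (hb n), h.memLp_limit, ?_⟩
  have h1 : Tendsto (fun n => ENNReal.ofReal C * eLpNorm (f n - 0) 2 P) l (𝓝 0) := by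
    simpa using ENNReal.Tendsto.const_mul h.tendsto (Or.inr ENNReal.ofReal_ne_top)
  refine tendsto_of_tendsto_of_tendsto_of_le_of_le tendsto_const_nhds h1
    (fun _ => zero_le) fun n => ?_
  simp only [sub_zero]
  refine eLpNorm_le_mul_eLpNorm_of_ae_le_mul ?_ 2
  filter_upwards [hb n] with ω hω
  rw [norm_mul]
  exact mul_le_mul_of_nonneg_right hω (norm_nonneg _)

/-- Dominated convergence in `L²` for a fixed function with bounded multipliers. -/
theorem TendstoMeanSquare.mul_of_ae_tendsto {u : ℕ → Ω → ℝ} {v F : Ω → ℝ} {C : ℝ}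
    (hF : MemLp F 2 P) (hu : ∀ n, AEStronglyMeasurable (u n) P)
    (hb : ∀ n, ∀ᵐ ω ∂P, |u n ω| ≤ C)
    (hlim : ∀ᵐ ω ∂P, Tendsto (fun n => u n ω) atTop (𝓝 (v ω))) :
    TendstoMeanSquare P (fun n ω => u n ω * F ω) atTop (fun ω => v ω * F ω) := by
  have hv : AEStronglyMeasurable v P := aestronglyMeasurable_of_tendsto_ae _ hu hlim
  have hvb : ∀ᵐ ω ∂P, |v ω| ≤ C := by
    filter_upwards [hlim, ae_all_iff.2 hb] with ω h1 h2
    exact le_of_tendsto h1.abs (Eventually.of_forall h2)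
  refine TendstoMeanSquare.of_integral (fun n => MemLp.bounded_mul hF (hu n) (hb n))
    (MemLp.bounded_mul hF hv hvb) ?_
  have key : Tendsto (fun n => ∫ ω, (u n ω * F ω - v ω * F ω) ^ 2 ∂P) atTop
      (𝓝 (∫ _, (0 : ℝ) ∂P)) := by
    refine tendsto_integral_of_dominated_convergence (fun ω => (2 * C) ^ 2 * F ω ^ 2)
      (fun n => (((hu n).mul hF.1).sub (hv.mul hF.1)).pow 2) (hF.integrable_sq.const_mul _)
      (fun n => ?_) ?_
    · filter_upwards [hb n, hvb] with ω h1 h2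
      have h3 : |u n ω - v ω| ≤ 2 * C := by
        have := abs_sub (u n ω) (v ω); linarith
      rw [Real.norm_eq_abs, abs_pow, sq_abs, ← sub_mul, mul_pow]
      refine mul_le_mul_of_nonneg_right ?_ (sq_nonneg _)
      rw [← sq_abs]
      gcongr
    · filter_upwards [hlim] with ω h
      have := (((h.mul_const (F ω)).sub_const (v ω * F ω)).pow 2)
      simpa using this
  simpa using key

/-- Continuity of the `L²` inner product. It pairs the converging gradients with the converging
difference quotients of the density. -/
theorem TendstoMeanSquare.integral_mul {ι : Type*} {l : Filter ι} {f f' : ι → Ω → ℝ}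
    {g g' : Ω → ℝ} (h : TendstoMeanSquare P f l g) (h' : TendstoMeanSquare P f' l g') :
    Tendsto (fun n => ∫ ω, f n ω * f' n ω ∂P) l (𝓝 (∫ ω, g ω * g' ω ∂P)) := by
  have e : ∀ {a b : Ω → ℝ} (ha : MemLp a 2 P) (hb : MemLp b 2 P),
      inner ℝ (ha.toLp a) (hb.toLp b) = ∫ ω, a ω * b ω ∂P := by
    intro a b ha hb
    rw [L2.inner_def]
    refine integral_congr_ae ?_
    filter_upwards [ha.coeFn_toLp, hb.coeFn_toLp] with ω h1 h2
    rw [h1, h2]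
    simp [mul_comm]
  have t1 := (Lp.tendsto_Lp_iff_tendsto_eLpNorm'' f h.memLp g h.memLp_limit).2 h.tendsto
  have t2 := (Lp.tendsto_Lp_iff_tendsto_eLpNorm'' f' h'.memLp g' h'.memLp_limit).2 h'.tendsto
  have t3 := t1.inner (𝕜 := ℝ) t2
  rw [e] at t3
  exact t3.congr fun n => e _ _

/-- Conditional expectation is a contraction of `L²`. -/
theorem TendstoMeanSquare.condExp {ι : Type*} {l : Filter ι} [IsProbabilityMeasure P]
    {f : ι → Ω → ℝ} {g : Ω → ℝ} (m : MeasurableSpace Ω)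
    (h : TendstoMeanSquare P f l g) :
    TendstoMeanSquare P (fun n => P[f n | m]) l (P[g | m]) := by
  refine ⟨fun n => (h.memLp n).condExp (by norm_num), h.memLp_limit.condExp (by norm_num), ?_⟩
  refine tendsto_of_tendsto_of_tendsto_of_le_of_le tendsto_const_nhds h.tendsto
    (fun _ => zero_le) fun n => ?_
  rw [← eLpNorm_congr_ae (condExp_sub ((h.memLp n).integrable (by norm_num))
    (h.memLp_limit.integrable (by norm_num)) m)]
  exact eLpNorm_condExp_le_eLpNorm _ (by norm_num)

/-- Mean square convergence along a sequence gives almost sure convergence along a subsequence. -/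
theorem TendstoMeanSquare.exists_seq_tendsto_ae {f : ℕ → Ω → ℝ} {g : Ω → ℝ}
    (h : TendstoMeanSquare P f atTop g) :
    ∃ ns : ℕ → ℕ, StrictMono ns ∧
      ∀ᵐ ω ∂P, Tendsto (fun n => f (ns n) ω) atTop (𝓝 (g ω)) :=
  (tendstoInMeasure_of_tendsto_eLpNorm (by norm_num) (fun n => (h.memLp n).1) h.memLp_limit.1
    h.tendsto).exists_seq_tendsto_ae

end MeanSquare

/-! ## Conditional expectations -/

section CondExp

variable {Ω : Type*} {m0 : MeasurableSpace Ω} {P : Measure Ω} [IsProbabilityMeasure P]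

/-- Integrated form of the pull-out property. -/
theorem integral_mul_condExp_of_aestronglyMeasurable {m : MeasurableSpace Ω} (hm : m ≤ m0)
    {f g : Ω → ℝ} (hf : AEStronglyMeasurable[m] f P) (hg : Integrable g P)
    (hfg : Integrable (fun ω => f ω * g ω) P) :
    ∫ ω, f ω * (P[g | m]) ω ∂P = ∫ ω, f ω * g ω ∂P := by
  rw [← integral_condExp hm (f := fun ω => f ω * g ω)]
  exact integral_congr_ae (condExp_mul_of_aestronglyMeasurable_left hf hfg hg).symm

/-- The conditional expectation is self-adjoint on `L²`. -/
theorem integral_mul_condExp_comm {m : MeasurableSpace Ω} (hm : m ≤ m0)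
    {f g : Ω → ℝ} (hf : MemLp f 2 P) (hg : MemLp g 2 P) :
    ∫ ω, f ω * (P[g | m]) ω ∂P = ∫ ω, (P[f | m]) ω * g ω ∂P := by
  have hf' : MemLp (P[f | m]) 2 P := hf.condExp (by norm_num)
  have hg' : MemLp (P[g | m]) 2 P := hg.condExp (by norm_num)
  rw [← integral_mul_condExp_of_aestronglyMeasurable hm
    stronglyMeasurable_condExp.aestronglyMeasurable (hg.integrable (by norm_num))
    (hf'.integrable_mul hg)]
  simp_rw [mul_comm (f _), mul_comm ((P[f | m]) _)]
  rw [integral_mul_condExp_of_aestronglyMeasurable hm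
    stronglyMeasurable_condExp.aestronglyMeasurable (hf.integrable (by norm_num))
    (hg'.integrable_mul hf)]

theorem condExp_mem_Icc {m : MeasurableSpace Ω} (hm : m ≤ m0) {f : Ω → ℝ} {a b : ℝ}
    (hf : Integrable f P) (h : ∀ᵐ ω ∂P, f ω ∈ Set.Icc a b) :
    ∀ᵐ ω ∂P, (P[f | m]) ω ∈ Set.Icc a b := by
  have h1 := condExp_mono (m := m) (integrable_const a) hf
    (by filter_upwards [h] with ω hω using hω.1)
  have h2 := condExp_mono (m := m) hf (integrable_const b)
    (by filter_upwards [h] with ω hω using hω.2)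
  rw [condExp_const hm] at h1 h2
  filter_upwards [h1, h2] with ω h3 h4 using ⟨h3, h4⟩

end CondExp

/-! ## Reweighted regressions under a likelihood ratio -/

section Reweighted

variable {Ω : Type*} {m0 : MeasurableSpace Ω}

/-- `E_Q[f | m]` for `dQ = p dP`, expressed through conditional expectations under `P`. -/
noncomputable def condRatio (P : Measure Ω) (m : MeasurableSpace Ω) (p f : Ω → ℝ) (ω : Ω) : ℝ :=
  (P[fun x => f x * p x | m]) ω / (P[p | m]) ω

/-- The difference `E_Q[Z | mW] - E_Q[Z | mL]` for `dQ = p dP`. -/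
noncomputable def condKappa (P : Measure Ω) (mL mW : MeasurableSpace Ω) (Z p : Ω → ℝ) (ω : Ω) : ℝ :=
  condRatio P mW p Z ω - condRatio P mL p Z ω

/-- The weighted regression ratio under `dQ = p dP`. -/
noncomputable def condMu (P : Measure Ω) (mL mW : MeasurableSpace Ω) (Y Z p : Ω → ℝ) (ω : Ω) : ℝ :=
  (condRatio P mW p (fun x => Y x * Z x) ω - condRatio P mW p Y ω * condRatio P mL p Z ω) /
    condKappa P mL mW Z p ω

/-- The inverse of `condKappa`, restricted to `N`. -/
noncomputable def invKappa (P : Measure Ω) (mL mW : MeasurableSpace Ω) (Z : Ω → ℝ) (N : Set Ω)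
    (p : Ω → ℝ) : Ω → ℝ :=
  N.indicator fun ω => (condKappa P mL mW Z p ω)⁻¹

/-- The residual `Y - μ` under the baseline law. -/
noncomputable def residual (P : Measure Ω) (mL mW : MeasurableSpace Ω) (Y Z : Ω → ℝ) (ω : Ω) : ℝ :=
  Y ω - condMu P mL mW Y Z (fun _ => 1) ω

/-- The gradient of the weighted functional with nuisance weights evaluated at `p`. -/
noncomputable def gradAt (P : Measure Ω) (mA mL mW : MeasurableSpace Ω) (Y Z : Ω → ℝ)
    (N : Set Ω) (p : Ω → ℝ) (ω : Ω) : ℝ :=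
  (Z ω - (P[Z | mL]) ω) *
      ((invKappa P mL mW Z N p ω * (P[p | mA]) ω * (P[p | mL]) ω / (P[p | mW]) ω) *
          residual P mL mW Y Z ω
        - (P[fun x => (invKappa P mL mW Z N p x * p x * (P[p | mA]) x / (P[p | mW]) x) *
            residual P mL mW Y Z x | mL]) ω)
    + (P[fun x => (P[p | mL]) x * condMu P mL mW Y Z (fun _ => 1) x | mA]) ω
    + (P[condMu P mL mW Y Z (fun _ => 1) | mL]) ω

/-- The weighted functional under `dQ = p dP`. -/
noncomputable def weightedPsi (P : Measure Ω) (mA mL mW : MeasurableSpace Ω) (Y Z p : Ω → ℝ) : ℝ :=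
  ∫ ω, condMu P mL mW Y Z p ω * ((P[p | mA]) ω * (P[p | mL]) ω) ∂P

/-- `p` is a density bounded above by `K` and below by `1 / K`. -/
structure IsRatio (P : Measure Ω) (p : Ω → ℝ) (K : ℝ) : Prop where
  measurable : Measurable p
  one_le : 1 ≤ K
  mem_Icc : ∀ᵐ ω ∂P, p ω ∈ Set.Icc K⁻¹ K

/-- Standing assumptions on the σ-algebras, the outcome, the bounded instrument, and the relevance
set `N`. -/
structure IsModel (P : Measure Ω) (mA mL mW : MeasurableSpace Ω) (Y Z : Ω → ℝ) (B : ℝ)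
    (N : Set Ω) : Prop where
  leA : mA ≤ mW
  leL : mL ≤ mW
  le : mW ≤ m0
  memLp : MemLp Y 2 P
  measurable : Measurable[m0] Z
  bound : ∀ ω, |Z ω| ≤ B
  measurableSet : MeasurableSet[mW] N
  zero : ∀ ω, ω ∉ N → Y ω = 0

variable {P : Measure Ω} [IsProbabilityMeasure P] {mA mL mW : MeasurableSpace Ω}
  {Y Z p : Ω → ℝ} {B K ε : ℝ} {N : Set Ω}

theorem isRatio_one (hK : 1 ≤ K) : IsRatio P (fun _ => 1) K :=
  ⟨measurable_const, hK, Eventually.of_forall fun _ => ⟨inv_le_one_of_one_le₀ hK, hK⟩⟩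

namespace IsRatio

theorem pos (h : IsRatio P p K) : 0 < K := lt_of_lt_of_le one_pos h.one_le

theorem abs_le (h : IsRatio P p K) : ∀ᵐ ω ∂P, |p ω| ≤ K := by
  filter_upwards [h.mem_Icc] with ω hω
  have := inv_pos.2 h.pos
  rw [abs_of_nonneg (this.le.trans hω.1)]
  exact hω.2

theorem integrable (h : IsRatio P p K) : Integrable p P :=
  Integrable.of_bound h.measurable.aestronglyMeasurable K h.abs_le

theorem condExp_mem (h : IsRatio P p K) {m : MeasurableSpace Ω} (hm : m ≤ m0) :
    ∀ᵐ ω ∂P, (P[p | m]) ω ∈ Set.Icc K⁻¹ K :=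
  condExp_mem_Icc hm h.integrable h.mem_Icc

theorem mul_integrable (h : IsRatio P p K) {f : Ω → ℝ} (hf : Integrable f P) :
    Integrable (fun ω => f ω * p ω) P :=
  hf.mul_bdd h.measurable.aestronglyMeasurable h.abs_le

theorem mul_memLp (h : IsRatio P p K) {f : Ω → ℝ} (hf : MemLp f 2 P) :
    MemLp (fun ω => f ω * p ω) 2 P := by
  simpa only [mul_comm] using MemLp.bounded_mul hf h.measurable.aestronglyMeasurable h.abs_le

end IsRatio

theorem condRatio_one {m : MeasurableSpace Ω} (hm : m ≤ m0) (f : Ω → ℝ) :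
    condRatio P m (fun _ => 1) f = P[f | m] := by
  ext ω
  simp [condRatio, condExp_const hm]

theorem measurable_condRatio {m : MeasurableSpace Ω} (f : Ω → ℝ) :
    Measurable[m] (condRatio P m p f) :=
  stronglyMeasurable_condExp.measurable.div stronglyMeasurable_condExp.measurable

/-- The indicator of `N` makes the bound global, although `κ` may vanish off `N`. -/
theorem invKappa_bound (hε : 0 < ε)
    (hκ : ∀ᵐ ω ∂P, ω ∈ N → ε ≤ |condKappa P mL mW Z p ω|) :
    ∀ᵐ ω ∂P, |invKappa P mL mW Z N p ω| ≤ ε⁻¹ := by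
  filter_upwards [hκ] with ω h1
  by_cases hω : ω ∈ N
  · simp only [invKappa, hω, Set.indicator_of_mem, abs_inv]
    exact inv_anti₀ hε (h1 hω)
  · simp only [invKappa, hω, not_false_eq_true, Set.indicator_of_notMem, abs_zero]
    exact (inv_pos.2 hε).le

theorem condRatio_memLp {m : MeasurableSpace Ω} (hm : m ≤ m0) (hp : IsRatio P p K) {f : Ω → ℝ}
    (hf : MemLp f 2 P) : MemLp (condRatio P m p f) 2 P := by
  have h1 : MemLp (P[fun x => f x * p x | m]) 2 P := (hp.mul_memLp hf).condExp (by norm_num)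
  have h2 := MemLp.bounded_mul (f := fun ω => ((P[p | m]) ω)⁻¹) (C := K) h1
    (stronglyMeasurable_condExp.measurable.inv.mono hm le_rfl).aestronglyMeasurable (by
      filter_upwards [hp.condExp_mem hm] with ω hω
      have := inv_pos.2 hp.pos
      rw [abs_of_nonneg (inv_nonneg.2 (this.le.trans hω.1))]
      exact inv_le_of_inv_le₀ hp.pos hω.1)
  refine h2.ae_eq (Eventually.of_forall fun ω => ?_)
  simp only [condRatio]
  rw [mul_comm, div_eq_mul_inv]

namespace IsModel

variable (h : IsModel P mA mL mW Y Z B N)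
include h

theorem measurable_condKappa : Measurable[mW] (condKappa P mL mW Z p) :=
  (measurable_condRatio _).sub ((measurable_condRatio _).mono h.leL le_rfl)

theorem measurable_condMu : Measurable[mW] (condMu P mL mW Y Z p) :=
  ((measurable_condRatio _).sub ((measurable_condRatio _).mul
    ((measurable_condRatio _).mono h.leL le_rfl))).div h.measurable_condKappa

theorem measurable_invKappa : Measurable[mW] (invKappa P mL mW Z N p) :=
  h.measurable_condKappa.inv.indicator h.measurableSet

theorem integrable_Z : Integrable Z P :=
  Integrable.of_bound h.measurable.aestronglyMeasurable B (Eventually.of_forall h.bound)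

theorem condExp_Z_bound {m : MeasurableSpace Ω} (hm : m ≤ m0) : ∀ᵐ ω ∂P, |(P[Z | m]) ω| ≤ B := by
  filter_upwards [condExp_mem_Icc hm h.integrable_Z
    (Eventually.of_forall fun ω => abs_le.1 (h.bound ω))] with ω hω using abs_le.2 hω

theorem condExp_eq_zero {f : Ω → ℝ} (hf : Integrable f P) (h0 : ∀ ω, ω ∉ N → f ω = 0) :
    ∀ᵐ ω ∂P, ω ∉ N → (P[f | mW]) ω = 0 := by
  have h1 : N.indicator f = f := by
    ext ω
    by_cases hω : ω ∈ N
    · simp [hω]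
    · simp [hω, h0 ω hω]
  have h2 := condExp_indicator (m := mW) hf h.measurableSet
  rw [h1] at h2
  filter_upwards [h2] with ω hω hn
  rw [hω]
  simp [hn]

theorem mul_Z_memLp {f : Ω → ℝ} (hf : MemLp f 2 P) : MemLp (fun ω => f ω * Z ω) 2 P := by
  simpa only [mul_comm] using MemLp.bounded_mul hf h.measurable.aestronglyMeasurable
    (Eventually.of_forall h.bound)

theorem condRatio_eq_zero (hp : IsRatio P p K) {f : Ω → ℝ} (hf : Integrable f P)
    (h0 : ∀ ω, ω ∉ N → f ω = 0) :
    ∀ᵐ ω ∂P, ω ∉ N → condRatio P mW p f ω = 0 := by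
  filter_upwards [h.condExp_eq_zero (hp.mul_integrable hf) (fun ω hω => by simp [h0 ω hω])]
    with ω h1 hω
  simp [condRatio, h1 hω]

/-- The outcome vanishes off the `mW`-measurable set `N`, hence so does the numerator of the ratio,
whatever the denominator is. This is why `κ` has to be controlled on `N` only. -/
theorem condMu_eq_zero (hp : IsRatio P p K) :
    ∀ᵐ ω ∂P, ω ∉ N → condMu P mL mW Y Z p ω = 0 := by
  filter_upwards [h.condRatio_eq_zero hp (h.memLp.integrable (by norm_num)) h.zero,
    h.condRatio_eq_zero hp ((h.mul_Z_memLp h.memLp).integrable (by norm_num))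
      (fun ω hω => by simp [h.zero ω hω])] with ω h1 h2 hω
  simp [condMu, h1 hω, h2 hω]

/-- Condition `-B p ≤ Z p ≤ B p` and divide by `E[p | m] > 0`. -/
theorem condRatio_Z_bound {m : MeasurableSpace Ω} (hm : m ≤ m0) (hp : IsRatio P p K) :
    ∀ᵐ ω ∂P, |condRatio P m p Z ω| ≤ B := by
  have hZp := hp.mul_integrable h.integrable_Z
  have h1 := condExp_mono (m := m) hZp (hp.integrable.const_mul B) (by
    filter_upwards [hp.mem_Icc] with ω hω
    have : 0 ≤ p ω := (inv_pos.2 hp.pos).le.trans hω.1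
    exact mul_le_mul_of_nonneg_right (abs_le.1 (h.bound ω)).2 this)
  have h2 := condExp_mono (m := m) (hp.integrable.const_mul (-B)) hZp (by
    filter_upwards [hp.mem_Icc] with ω hω
    have : 0 ≤ p ω := (inv_pos.2 hp.pos).le.trans hω.1
    exact mul_le_mul_of_nonneg_right (abs_le.1 (h.bound ω)).1 this)
  filter_upwards [h1, h2, hp.condExp_mem hm, condExp_smul (m := m) (μ := P) B p,
    condExp_smul (m := m) (μ := P) (-B) p] with ω h3 h4 h5 h6 h7
  have h5 : 0 < (P[p | m]) ω := (inv_pos.2 hp.pos).trans_le h5.1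
  have e1 : (P[fun x => B * p x | m]) ω = B * (P[p | m]) ω := h6
  have e2 : (P[fun x => -B * p x | m]) ω = -B * (P[p | m]) ω := h7
  rw [e1] at h3
  rw [e2] at h4
  rw [condRatio, abs_le]
  exact ⟨(le_div_iff₀ h5).2 h4, (div_le_iff₀ h5).2 h3⟩

theorem condMu_memLp (hp : IsRatio P p K) (hε : 0 < ε)
    (hκ : ∀ᵐ ω ∂P, ω ∈ N → ε ≤ |condKappa P mL mW Z p ω|) :
    MemLp (condMu P mL mW Y Z p) 2 P := by
  have h1 := condRatio_memLp h.le hp (h.mul_Z_memLp h.memLp)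
  have h2 := MemLp.bounded_mul (condRatio_memLp h.le hp h.memLp)
    (((measurable_condRatio (P := P) (p := p) Z).mono (h.leL.trans h.le)
      le_rfl).aestronglyMeasurable)
    (h.condRatio_Z_bound (h.leL.trans h.le) hp)
  have h3 := MemLp.bounded_mul (h1.sub h2)
    (h.measurable_invKappa.mono h.le le_rfl).aestronglyMeasurable (invKappa_bound hε hκ)
  refine h3.ae_eq ?_
  filter_upwards [h.condMu_eq_zero hp] with ω h4
  by_cases hω : ω ∈ N
  · simp only [invKappa, hω, Set.indicator_of_mem, condMu, Pi.sub_apply]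
    rw [div_eq_inv_mul, mul_comm (condRatio P mL p Z ω)]
  · simp [invKappa, hω, h4 hω]

theorem residual_memLp (hε : 0 < ε)
    (hκ : ∀ᵐ ω ∂P, ω ∈ N → ε ≤ |condKappa P mL mW Z (fun _ => 1) ω|) :
    MemLp (residual P mL mW Y Z) 2 P :=
  h.memLp.sub (h.condMu_memLp (isRatio_one le_rfl) hε hκ)

theorem sub_condExp_memLp {f : Ω → ℝ} (hf : MemLp f 2 P) :
    MemLp (fun ω => (Z ω - (P[Z | mL]) ω) * f ω) 2 P := by
  refine MemLp.bounded_mul (C := B + B) hf (h.integrable_Z.1.sub integrable_condExp.1) ?_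
  filter_upwards [h.condExp_Z_bound (h.leL.trans h.le)] with ω hω
  exact (abs_sub _ _).trans (add_le_add (h.bound ω) hω)

end IsModel

end Reweighted

/-! ### Exact expansion of the weighted functional -/

section Expansion

variable {Ω : Type*} {m0 : MeasurableSpace Ω} {P : Measure Ω} [IsProbabilityMeasure P]
  {mA mL mW : MeasurableSpace Ω} {Y Z p : Ω → ℝ} {B K ε : ℝ} {N : Set Ω}

theorem condExp_mul_of_memLp {m : MeasurableSpace Ω} {f g : Ω → ℝ}
    (hfm : AEStronglyMeasurable[m] f P) (hf : MemLp f 2 P) (hg : MemLp g 2 P) :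
    P[fun ω => f ω * g ω | m] =ᵐ[P] fun ω => f ω * (P[g | m]) ω :=
  condExp_mul_of_aestronglyMeasurable_left hfm (hf.integrable_mul hg)
    (hg.integrable (by norm_num))

theorem integral_sub_add_add {a b c d : Ω → ℝ} (ha : Integrable a P) (hb : Integrable b P)
    (hc : Integrable c P) (hd : Integrable d P) :
    ∫ ω, (a ω - b ω + c ω + d ω) ∂P = ∫ ω, a ω ∂P - ∫ ω, b ω ∂P + ∫ ω, c ω ∂P + ∫ ω, d ω ∂P := by
  rw [integral_add (f := fun ω => a ω - b ω + c ω) ((ha.sub hb).add hc) hd,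
    integral_add (f := fun ω => a ω - b ω) (ha.sub hb) hc, integral_sub ha hb]

/-- The inverse of `κ` contributes `ε⁻¹`; each of `a`, `b` and `e⁻¹` contributes one factor `K`. -/
theorem abs_mul_mul_div_le {r a b e : ℝ} (hK : 0 < K) (hr : |r| ≤ ε⁻¹)
    (ha : a ∈ Set.Icc K⁻¹ K) (hb : b ∈ Set.Icc K⁻¹ K) (he : e ∈ Set.Icc K⁻¹ K) :
    |r * a * b / e| ≤ ε⁻¹ * K * K * K := by
  have hK' := inv_pos.2 hK
  have ha0 := hK'.trans_le ha.1
  have hb0 := hK'.trans_le hb.1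
  have he0 := hK'.trans_le he.1
  have hr0 := (abs_nonneg r).trans hr
  rw [div_eq_mul_inv, abs_mul, abs_mul, abs_mul, abs_of_pos ha0, abs_of_pos hb0,
    abs_of_pos (inv_pos.2 he0)]
  have h1 : e⁻¹ ≤ K := inv_le_of_inv_le₀ hK he.1
  have h2 := ha.2
  have h3 := hb.2
  gcongr

namespace IsRatio

theorem memLp (hp : IsRatio P p K) : MemLp p 2 P :=
  MemLp.of_bound hp.measurable.aestronglyMeasurable K hp.abs_le

theorem weight_bound (hp : IsRatio P p K) (hA : mA ≤ m0) (hL : mL ≤ m0) (hW : mW ≤ m0)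
    (hε : 0 < ε) (hκ : ∀ᵐ ω ∂P, ω ∈ N → ε ≤ |condKappa P mL mW Z p ω|) :
    ∀ᵐ ω ∂P, |invKappa P mL mW Z N p ω * (P[p | mA]) ω * (P[p | mL]) ω / (P[p | mW]) ω|
      ≤ ε⁻¹ * K * K * K := by
  filter_upwards [invKappa_bound hε hκ, hp.condExp_mem hA, hp.condExp_mem hL, hp.condExp_mem hW]
    with ω h1 h2 h3 h4 using abs_mul_mul_div_le hp.pos h1 h2 h3 h4

theorem weight_bound' (hp : IsRatio P p K) (hA : mA ≤ m0) (hW : mW ≤ m0)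
    (hε : 0 < ε) (hκ : ∀ᵐ ω ∂P, ω ∈ N → ε ≤ |condKappa P mL mW Z p ω|) :
    ∀ᵐ ω ∂P, |invKappa P mL mW Z N p ω * p ω * (P[p | mA]) ω / (P[p | mW]) ω|
      ≤ ε⁻¹ * K * K * K := by
  filter_upwards [invKappa_bound hε hκ, hp.condExp_mem hA, hp.mem_Icc, hp.condExp_mem hW]
    with ω h1 h2 h3 h4 using abs_mul_mul_div_le hp.pos h1 h3 h2 h4

end IsRatio

namespace IsModel

variable (h : IsModel P mA mL mW Y Z B N)
include h

theorem condExp_Z_memLp {m : MeasurableSpace Ω} : MemLp (P[Z | m]) 2 P :=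
  (MemLp.of_bound h.integrable_Z.1 B (Eventually.of_forall h.bound)).condExp (by norm_num)

theorem aestronglyMeasurable_rho {m : MeasurableSpace Ω} (hm : mL ≤ m) :
    AEStronglyMeasurable[m] (P[Z | mL]) P :=
  (stronglyMeasurable_condExp.mono hm).aestronglyMeasurable

theorem condExp_residual (hε : 0 < ε)
    (hκ : ∀ᵐ ω ∂P, ω ∈ N → ε ≤ |condKappa P mL mW Z (fun _ => 1) ω|) (hp : IsRatio P p K) :
    P[fun ω => residual P mL mW Y Z ω * p ω | mW] =ᵐ[P] fun ω =>
      (P[fun ω => Y ω * p ω | mW]) ω - condMu P mL mW Y Z (fun _ => 1) ω * (P[p | mW]) ω := by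
  have hμ := h.condMu_memLp (isRatio_one (le_refl 1)) hε hκ
  have e : (fun ω => residual P mL mW Y Z ω * p ω) =
      (fun ω => Y ω * p ω) - fun ω => condMu P mL mW Y Z (fun _ => 1) ω * p ω := by
    ext ω; simp [residual, sub_mul]
  rw [e]
  filter_upwards [condExp_sub (m := mW) ((hp.mul_memLp h.memLp).integrable (by norm_num))
      (g := fun ω => condMu P mL mW Y Z (fun _ => 1) ω * p ω) (hμ.integrable_mul hp.memLp),
    condExp_mul_of_memLp (h.measurable_condMu.stronglyMeasurable.aestronglyMeasurable) hμ hp.memLp]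
    with ω h1 h2
  rw [Pi.sub_apply] at h1
  rw [h1, h2]

theorem condExp_residual_mul (hε : 0 < ε)
    (hκ : ∀ᵐ ω ∂P, ω ∈ N → ε ≤ |condKappa P mL mW Z (fun _ => 1) ω|) (hp : IsRatio P p K) :
    P[fun ω => residual P mL mW Y Z ω * ((Z ω - (P[Z | mL]) ω) * p ω) | mW] =ᵐ[P] fun ω =>
      (P[fun ω => Y ω * Z ω * p ω | mW]) ω - (P[Z | mL]) ω * (P[fun ω => Y ω * p ω | mW]) ω
      - condMu P mL mW Y Z (fun _ => 1) ω *
        ((P[fun ω => Z ω * p ω | mW]) ω - (P[Z | mL]) ω * (P[p | mW]) ω) := by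
  have hμ := h.condMu_memLp (isRatio_one (le_refl 1)) hε hκ
  have hμm : AEStronglyMeasurable[mW] (condMu P mL mW Y Z (fun _ => 1)) P :=
    h.measurable_condMu.stronglyMeasurable.aestronglyMeasurable
  have hρm := h.aestronglyMeasurable_rho h.leL
  have hρ := h.condExp_Z_memLp (m := mL)
  have hYp := hp.mul_memLp h.memLp
  have hYZp := hp.mul_memLp (h.mul_Z_memLp h.memLp)
  have hZp : MemLp (fun ω => Z ω * p ω) 2 P := by
    simpa only [mul_comm] using h.mul_Z_memLp hp.memLp
  have hρp := hp.mul_memLp hρ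
  have e : (fun ω => residual P mL mW Y Z ω * ((Z ω - (P[Z | mL]) ω) * p ω)) =
      ((fun ω => Y ω * Z ω * p ω) - fun ω => (P[Z | mL]) ω * (Y ω * p ω)) -
      (fun ω => condMu P mL mW Y Z (fun _ => 1) ω *
        ((fun ω => Z ω * p ω) - fun ω => (P[Z | mL]) ω * p ω) ω) := by
    ext ω; simp only [residual, Pi.sub_apply]; ring
  rw [e]
  have i1 := hYZp.integrable (q := 2) (by norm_num)
  have i2 : Integrable (fun ω => (P[Z | mL]) ω * (Y ω * p ω)) P := hρ.integrable_mul hYp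
  have i3 := hZp.sub hρp
  have i4 : Integrable (fun ω => condMu P mL mW Y Z (fun _ => 1) ω *
      ((fun ω => Z ω * p ω) - fun ω => (P[Z | mL]) ω * p ω) ω) P := hμ.integrable_mul i3
  filter_upwards [condExp_sub (m := mW) (i1.sub i2) i4,
    condExp_sub (m := mW) i1 i2, condExp_mul_of_memLp hρm hρ hYp,
    condExp_mul_of_memLp hμm hμ i3,
    condExp_sub (m := mW) (hZp.integrable (by norm_num)) (hρp.integrable (by norm_num)),
    condExp_mul_of_memLp hρm hρ hp.memLp] with ω h1 h2 h3 h4 h5 h6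
  refine h1.trans ?_
  rw [Pi.sub_apply] at h2 h5 ⊢
  rw [h2, h3, h4, h5, h6]

/-- The moment condition characterising `μ`. On `N` it is the definition of `μ` multiplied by `κ ≠
0`; off `N` both the outcome and `μ` vanish. -/
theorem condExp_residual_mul_baseline (hε : 0 < ε)
    (hκ : ∀ᵐ ω ∂P, ω ∈ N → ε ≤ |condKappa P mL mW Z (fun _ => 1) ω|) :
    P[fun ω => residual P mL mW Y Z ω * (Z ω - (P[Z | mL]) ω) | mW] =ᵐ[P] 0 := by
  have h1 := h.condExp_residual_mul hε hκ (isRatio_one (le_refl 1))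
  simp only [mul_one] at h1
  filter_upwards [h1, hκ, h.condMu_eq_zero (isRatio_one (le_refl 1)),
    h.condExp_eq_zero (h.memLp.integrable (by norm_num)) h.zero,
    h.condExp_eq_zero ((h.mul_Z_memLp h.memLp).integrable (by norm_num))
      (fun ω hω => by simp [h.zero ω hω])] with ω h1 h2 h3 h4 h5
  rw [h1, condExp_const h.le, Pi.zero_apply]
  by_cases hω : ω ∈ N
  · have hk : condKappa P mL mW Z (fun _ => 1) ω ≠ 0 := by
      intro h0
      have := h2 hω
      rw [h0, abs_zero] at this
      linarith
    have e1 : condKappa P mL mW Z (fun _ => 1) ω = (P[Z | mW]) ω - (P[Z | mL]) ω := by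
      simp [condKappa, condRatio_one h.le, condRatio_one (h.leL.trans h.le)]
    rw [mul_one, ← e1, condMu, div_mul_cancel₀ _ hk]
    simp only [condRatio_one h.le, condRatio_one (h.leL.trans h.le)]
    ring
  · simp [h3 hω, h4 hω, h5 hω]

/-- Since `E[Z - ρ | L] = 0`, the `-1` contributes nothing. Dividing the right-hand side by `E[p |
L]` gives the change `ρ_p - ρ`. -/
theorem condExp_score_instrument (hp : IsRatio P p K) :
    P[fun ω => (Z ω - (P[Z | mL]) ω) * (p ω - 1) | mL] =ᵐ[P] fun ω =>
      (P[fun ω => Z ω * p ω | mL]) ω - (P[Z | mL]) ω * (P[p | mL]) ω := by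
  have hL := h.leL.trans h.le
  have hρm := h.aestronglyMeasurable_rho (le_refl mL)
  have hρ := h.condExp_Z_memLp (m := mL)
  have hZp : Integrable (fun ω => Z ω * p ω) P := hp.mul_integrable h.integrable_Z
  have hρp := hp.mul_memLp hρ
  have e : (fun ω => (Z ω - (P[Z | mL]) ω) * (p ω - 1)) =
      ((fun ω => Z ω * p ω) - fun ω => (P[Z | mL]) ω * p ω) - (Z - P[Z | mL]) := by
    ext ω; simp only [Pi.sub_apply]; ring
  rw [e]
  have i2 := hρp.integrable (q := 2) (by norm_num)
  filter_upwards [condExp_sub (m := mL) (hZp.sub i2) (h.integrable_Z.sub integrable_condExp),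
    condExp_sub (m := mL) hZp i2, condExp_mul_of_memLp hρm hρ hp.memLp,
    condExp_sub (m := mL) h.integrable_Z (integrable_condExp (m := mL) (f := Z))]
    with ω h1 h2 h3 h4
  refine h1.trans ?_
  rw [Pi.sub_apply] at h2 h4 ⊢
  rw [h2, h3, h4, condExp_of_stronglyMeasurable hL stronglyMeasurable_condExp integrable_condExp]
  ring

/-- Exact expansion of the weighted regression ratio around the baseline law. -/
theorem condMu_sub (hε : 0 < ε)
    (hκ : ∀ᵐ ω ∂P, ω ∈ N → ε ≤ |condKappa P mL mW Z (fun _ => 1) ω|) (hp : IsRatio P p K)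
    (hκp : ∀ᵐ ω ∂P, ω ∈ N → ε ≤ |condKappa P mL mW Z p ω|) :
    ∀ᵐ ω ∂P, condMu P mL mW Y Z p ω - condMu P mL mW Y Z (fun _ => 1) ω =
      invKappa P mL mW Z N p ω / (P[p | mW]) ω *
        ((P[fun ω => residual P mL mW Y Z ω * ((Z ω - (P[Z | mL]) ω) * (p ω - 1)) | mW]) ω
          - (P[fun ω => (Z ω - (P[Z | mL]) ω) * (p ω - 1) | mL]) ω / (P[p | mL]) ω *
            (P[fun ω => residual P mL mW Y Z ω * p ω | mW]) ω) := by
  have hV := h.residual_memLp hε hκ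
  have e : (fun ω => residual P mL mW Y Z ω * ((Z ω - (P[Z | mL]) ω) * (p ω - 1))) =
      (fun ω => residual P mL mW Y Z ω * ((Z ω - (P[Z | mL]) ω) * p ω)) -
        fun ω => residual P mL mW Y Z ω * (Z ω - (P[Z | mL]) ω) := by
    ext ω; simp only [Pi.sub_apply]; ring
  rw [e]
  have i1 : Integrable (fun ω => residual P mL mW Y Z ω * ((Z ω - (P[Z | mL]) ω) * p ω)) P :=
    hV.integrable_mul (h.sub_condExp_memLp hp.memLp)
  have i2 : Integrable (fun ω => residual P mL mW Y Z ω * (Z ω - (P[Z | mL]) ω)) P := by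
    have := h.sub_condExp_memLp hV
    simpa only [mul_comm] using this.integrable (by norm_num)
  filter_upwards [condExp_sub (m := mW) i1 i2, h.condExp_residual_mul hε hκ hp,
    h.condExp_residual_mul_baseline hε hκ, h.condExp_score_instrument hp,
    h.condExp_residual hε hκ hp, hκp, h.condMu_eq_zero (isRatio_one (le_refl 1)),
    h.condMu_eq_zero hp, hp.condExp_mem h.le, hp.condExp_mem (h.leL.trans h.le)]
    with ω h1 h2 h3 h4 h5 h6 h7 h8 h9 h10
  by_cases hω : ω ∈ N
  · rw [h1, Pi.sub_apply, h2, h3, h4, h5]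
    have hk : condKappa P mL mW Z p ω ≠ 0 := by
      intro h0
      have := h6 hω
      rw [h0, abs_zero] at this
      linarith
    have hK' := inv_pos.2 hp.pos
    have he : (P[p | mW]) ω ≠ 0 := (hK'.trans_le h9.1).ne'
    have hc : (P[p | mL]) ω ≠ 0 := (hK'.trans_le h10.1).ne'
    -- The baseline moment condition has already entered through `h3`; what is left is an algebraic
    -- identity valid for every value of `μ`.
    generalize condMu P mL mW Y Z (fun _ => 1) ω = μ
    simp only [invKappa, hω, Set.indicator_of_mem, condMu, Pi.zero_apply]
    -- Solving the definition of `κ_p` for `E[Z p | mW]` turns `κ_p` into a free nonzero variable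
    -- that can be cleared.
    have hk2 : (P[fun ω => Z ω * p ω | mW]) ω =
        (P[p | mW]) ω * (condKappa P mL mW Z p ω +
          (P[fun ω => Z ω * p ω | mL]) ω / (P[p | mL]) ω) := by
      simp only [condKappa, condRatio]
      field_simp
      ring
    rw [hk2]
    simp only [condRatio]
    field_simp
    ring
  -- Off `N` both ratios and the truncated inverse of `κ_p` are zero.
  · simp [invKappa, hω, h7 hω, h8 hω]

/-- The weighted functional along `dQ = p dP` is exactly linear in `p - 1`, with gradient
`gradAt`. -/
theorem weightedPsi_sub (hε : 0 < ε)
    (hκ : ∀ᵐ ω ∂P, ω ∈ N → ε ≤ |condKappa P mL mW Z (fun _ => 1) ω|) (hp : IsRatio P p K)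
    (hκp : ∀ᵐ ω ∂P, ω ∈ N → ε ≤ |condKappa P mL mW Z p ω|) :
    weightedPsi P mA mL mW Y Z p - weightedPsi P mA mL mW Y Z (fun _ => 1) =
      ∫ ω, gradAt P mA mL mW Y Z N p ω * (p ω - 1) ∂P := by
  have hL := h.leL.trans h.le
  have hA := h.leA.trans h.le
  have hV := h.residual_memLp hε hκ
  have hμ := h.condMu_memLp (isRatio_one (le_refl 1)) hε hκ
  have hμp := h.condMu_memLp hp hε hκp
  have hs : MemLp (fun ω => p ω - 1) 2 P := hp.memLp.sub (memLp_const 1)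
  have hX2 := h.sub_condExp_memLp hs
  have hVp := hp.mul_memLp hV
  have hbm : Measurable[mW] (P[p | mA]) := stronglyMeasurable_condExp.measurable.mono h.leA le_rfl
  have hcm : Measurable[mW] (P[p | mL]) := stronglyMeasurable_condExp.measurable.mono h.leL le_rfl
  have hem : Measurable[mW] (P[p | mW]) := stronglyMeasurable_condExp.measurable
  have hRm : Measurable[mW] (invKappa P mL mW Z N p) := h.measurable_invKappa
  have hum : Measurable[mW] (fun ω => invKappa P mL mW Z N p ω * (P[p | mA]) ω * (P[p | mL]) ω /
      (P[p | mW]) ω) := ((hRm.mul hbm).mul hcm).div hem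
  have hub := hp.weight_bound hA hL h.le hε hκp
  have hvm : Measurable[m0] (fun ω => invKappa P mL mW Z N p ω * p ω * (P[p | mA]) ω /
      (P[p | mW]) ω) := (((hRm.mono h.le le_rfl).mul hp.measurable).mul
        (hbm.mono h.le le_rfl)).div (hem.mono h.le le_rfl)
  have hvb := hp.weight_bound' (mL := mL) hA h.le hε hκp
  set u : Ω → ℝ := fun ω => invKappa P mL mW Z N p ω * (P[p | mA]) ω * (P[p | mL]) ω /
      (P[p | mW]) ω with hu
  set v : Ω → ℝ := fun ω => invKappa P mL mW Z N p ω * p ω * (P[p | mA]) ω /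
      (P[p | mW]) ω with hv
  set V := residual P mL mW Y Z with hVdef
  set μ := condMu P mL mW Y Z (fun _ => 1) with hμdef
  set X1 : Ω → ℝ := fun ω => V ω * ((Z ω - (P[Z | mL]) ω) * (p ω - 1)) with hX1def
  set X2 : Ω → ℝ := fun ω => (Z ω - (P[Z | mL]) ω) * (p ω - 1) with hX2def
  have huV : MemLp (fun ω => u ω * V ω) 2 P :=
    MemLp.bounded_mul hV (hum.mono h.le le_rfl).aestronglyMeasurable hub
  have hvV : MemLp (fun ω => v ω * V ω) 2 P :=
    MemLp.bounded_mul hV hvm.aestronglyMeasurable hvb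
  have hcμ : MemLp (fun ω => (P[p | mL]) ω * μ ω) 2 P := by
    refine MemLp.bounded_mul (C := K) hμ (hcm.mono h.le le_rfl).aestronglyMeasurable ?_
    filter_upwards [hp.condExp_mem hL] with ω hω
    rw [abs_of_nonneg ((inv_pos.2 hp.pos).le.trans hω.1)]
    exact hω.2
  have hX1 : Integrable X1 P := hV.integrable_mul hX2
  have hEX2 : MemLp (P[X2 | mL]) 2 P := hX2.condExp (by norm_num)
  have huX1 : Integrable (fun ω => u ω * X1 ω) P := by
    have : Integrable (fun ω => (u ω * V ω) * X2 ω) P := huV.integrable_mul hX2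
    simpa only [hX1def, hX2def, mul_assoc] using this
  have i1 : Integrable (fun ω => u ω * (P[X1 | mW]) ω) P :=
    (integrable_condExp (m := mW) (μ := P) (f := fun ω => u ω * X1 ω)).congr
      (condExp_mul_of_aestronglyMeasurable_left
        (hum.stronglyMeasurable.aestronglyMeasurable) huX1 hX1)
  -- The factor `E[p | mL]` of the product density cancels the denominator of `ρ_p - ρ`, so it is
  -- absent here. In `v` the density `p` comes from the term `V p`.
  set y : Ω → ℝ := fun ω => invKappa P mL mW Z N p ω * (P[p | mA]) ω / (P[p | mW]) ω *
      (P[X2 | mL]) ω with hy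
  have hym : AEStronglyMeasurable[mW] y P :=
    (((hRm.mul hbm).div hem).mul (stronglyMeasurable_condExp.measurable.mono h.leL
      le_rfl)).stronglyMeasurable.aestronglyMeasurable
  have hyV : Integrable (fun ω => y ω * (V ω * p ω)) P := by
    have : Integrable (fun ω => (v ω * V ω) * (P[X2 | mL]) ω) P := hvV.integrable_mul hEX2
    refine this.congr (Eventually.of_forall fun ω => ?_)
    simp only [hv, hy]
    ring
  have hVp1 : Integrable (fun ω => V ω * p ω) P := hVp.integrable (by norm_num)
  have i2 : Integrable (fun ω => y ω * (P[fun ω => V ω * p ω | mW]) ω) P :=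
    (integrable_condExp (m := mW) (μ := P) (f := fun ω => y ω * (V ω * p ω))).congr
      (condExp_mul_of_aestronglyMeasurable_left hym hyV hVp1)
  have hEsA : MemLp (P[fun ω => p ω - 1 | mA]) 2 P := hs.condExp (by norm_num)
  have hEsL : MemLp (P[fun ω => p ω - 1 | mL]) 2 P := hs.condExp (by norm_num)
  have i3 : Integrable (fun ω => ((P[p | mL]) ω * μ ω) * (P[fun ω => p ω - 1 | mA]) ω) P :=
    hcμ.integrable_mul hEsA
  have i4 : Integrable (fun ω => μ ω * (P[fun ω => p ω - 1 | mL]) ω) P := hμ.integrable_mul hEsL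
  have hcen : ∀ {m : MeasurableSpace Ω} (_ : m ≤ m0),
      P[fun ω => p ω - 1 | m] =ᵐ[P] fun ω => (P[p | m]) ω - 1 := by
    intro m hm
    have := condExp_sub (m := m) hp.integrable (integrable_const (μ := P) (1 : ℝ))
    rw [condExp_const hm] at this
    exact this
  -- Telescoping with `b = E[p | mA]` and `c = E[p | mL]`: `μ_p b c - μ = (μ_p - μ) b c + c μ (b -
  -- 1) + μ (c - 1)`, with the expansion of `μ_p - μ` inserted.
  have split : ∀ᵐ ω ∂P, condMu P mL mW Y Z p ω * ((P[p | mA]) ω * (P[p | mL]) ω) - μ ω =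
      ((u ω * (P[X1 | mW]) ω - y ω * (P[fun ω => V ω * p ω | mW]) ω) +
      ((P[p | mL]) ω * μ ω) * (P[fun ω => p ω - 1 | mA]) ω) +
      μ ω * (P[fun ω => p ω - 1 | mL]) ω := by
    filter_upwards [h.condMu_sub hε hκ hp hκp, hcen hA, hcen hL, hp.condExp_mem hL]
      with ω h1 h2 h3 h4
    have hc : (P[p | mL]) ω ≠ 0 := ((inv_pos.2 hp.pos).trans_le h4.1).ne'
    rw [h2, h3, sub_eq_iff_eq_add.1 h1]
    simp only [hu, hy]
    rw [← hμdef]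
    generalize (P[X1 | mW]) ω = x1
    generalize (P[X2 | mL]) ω = x2
    generalize (P[fun ω => V ω * p ω | mW]) ω = x3
    field_simp
    ring
  have hψ1 : weightedPsi P mA mL mW Y Z (fun _ => 1) = ∫ ω, μ ω ∂P := by
    simp [weightedPsi, condExp_const hA, condExp_const hL, hμdef]
  have iμp : Integrable (fun ω => condMu P mL mW Y Z p ω * ((P[p | mA]) ω * (P[p | mL]) ω)) P := by
    refine (hμp.integrable (by norm_num)).mul_bdd (c := K * K)
      ((hbm.mul hcm).mono h.le le_rfl).aestronglyMeasurable ?_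
    filter_upwards [hp.condExp_mem hL, hp.condExp_mem hA] with ω h1 h2
    have hK := (inv_pos.2 hp.pos).le
    rw [Real.norm_eq_abs, abs_mul, abs_of_nonneg (hK.trans h1.1), abs_of_nonneg (hK.trans h2.1)]
    exact mul_le_mul h2.2 h1.2 (hK.trans h1.1) hp.pos.le
  rw [hψ1, weightedPsi, ← integral_sub iμp (hμ.integrable (by norm_num)),
    integral_congr_ae split, integral_sub_add_add i1 i2 i3 i4]
  have t1 : ∫ ω, u ω * (P[X1 | mW]) ω ∂P = ∫ ω, (Z ω - (P[Z | mL]) ω) * (u ω * V ω) *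
      (p ω - 1) ∂P := by
    rw [integral_mul_condExp_of_aestronglyMeasurable h.le
      (hum.stronglyMeasurable.aestronglyMeasurable) hX1 huX1]
    refine integral_congr_ae (Eventually.of_forall fun ω => ?_)
    simp only [hX1def]
    ring
  have t2 : ∫ ω, y ω * (P[fun ω => V ω * p ω | mW]) ω ∂P = ∫ ω, (Z ω - (P[Z | mL]) ω) *
      (P[fun ω => v ω * V ω | mL]) ω * (p ω - 1) ∂P := by
    rw [integral_mul_condExp_of_aestronglyMeasurable h.le hym hVp1 hyV]
    -- Regrouping isolates `E[X2 | mL]`, so that self-adjointness can transfer the conditioning to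
    -- `v V`.
    have : ∫ ω, y ω * (V ω * p ω) ∂P = ∫ ω, (v ω * V ω) * (P[X2 | mL]) ω ∂P := by
      refine integral_congr_ae (Eventually.of_forall fun ω => ?_)
      simp only [hv, hy]
      ring
    rw [this, integral_mul_condExp_comm hL hvV hX2]
    refine integral_congr_ae (Eventually.of_forall fun ω => ?_)
    simp only [hX2def]
    ring
  rw [t1, t2, integral_mul_condExp_comm hA hcμ hs, integral_mul_condExp_comm hL hμ hs]
  have m1 : MemLp (fun ω => (Z ω - (P[Z | mL]) ω) * (u ω * V ω)) 2 P := h.sub_condExp_memLp huV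
  have m2 : MemLp (fun ω => (Z ω - (P[Z | mL]) ω) * (P[fun ω => v ω * V ω | mL]) ω) 2 P :=
    h.sub_condExp_memLp (hvV.condExp (by norm_num))
  have m3 : MemLp (P[fun ω => (P[p | mL]) ω * μ ω | mA]) 2 P := hcμ.condExp (by norm_num)
  have m4 : MemLp (P[μ | mL]) 2 P := hμ.condExp (by norm_num)
  refine (integral_sub_add_add (m1.integrable_mul hs) (m2.integrable_mul hs)
    (m3.integrable_mul hs) (m4.integrable_mul hs)).symm.trans ?_
  refine integral_congr_ae (Eventually.of_forall fun ω => ?_)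
  simp only [gradAt, hu, hv, Pi.mul_apply]
  ring

end IsModel

end Expansion

/-! ### Limits of the gradient and derivatives along differentiable paths -/

section Limits

variable {Ω : Type*} {m0 : MeasurableSpace Ω} {P : Measure Ω} [IsProbabilityMeasure P]
  {mA mL mW : MeasurableSpace Ω} {Y Z : Ω → ℝ} {B K ε : ℝ} {N : Set Ω}

theorem TendstoMeanSquare.sub_limit {ι : Type*} {l : Filter ι} {f : ι → Ω → ℝ} {g : Ω → ℝ}
    (h : TendstoMeanSquare P f l g) : TendstoMeanSquare P (fun n => f n - g) l 0 :=
  ⟨fun n => (h.memLp n).sub h.memLp_limit, MemLp.zero, by simpa using h.tendsto⟩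

theorem TendstoMeanSquare.of_sub {ι : Type*} {l : Filter ι} {f : ι → Ω → ℝ} {g : Ω → ℝ}
    (hg : MemLp g 2 P) (h : TendstoMeanSquare P (fun n => f n - g) l 0) :
    TendstoMeanSquare P f l g := by
  simpa using h.add (TendstoMeanSquare.const hg)

theorem TendstoMeanSquare.neg {ι : Type*} {l : Filter ι} {f : ι → Ω → ℝ} {g : Ω → ℝ}
    (h : TendstoMeanSquare P f l g) : TendstoMeanSquare P (fun n => -f n) l (-g) := by
  refine ⟨fun n => (h.memLp n).neg, h.memLp_limit.neg, h.tendsto.congr fun n => ?_⟩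
  rw [← eLpNorm_neg]
  congr 1
  abel

/-- Finitely many mean square convergent sequences converge almost surely along a common
subsequence. -/
theorem exists_common_seq_tendsto_ae {ι : Type*} (s : Finset ι) {f : ι → ℕ → Ω → ℝ}
    {g : ι → Ω → ℝ} (h : ∀ i, TendstoMeanSquare P (f i) atTop (g i)) :
    ∃ ns : ℕ → ℕ, StrictMono ns ∧
      ∀ i ∈ s, ∀ᵐ ω ∂P, Tendsto (fun n => f i (ns n) ω) atTop (𝓝 (g i ω)) := by
  classical
  induction s using Finset.induction_on with
  | empty => exact ⟨id, strictMono_id, by simp⟩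
  | insert i s _ ih =>
    obtain ⟨ns, hns, hs⟩ := ih
    obtain ⟨ms, hms, hi⟩ := ((h i).comp hns.tendsto_atTop).exists_seq_tendsto_ae
    refine ⟨ns ∘ ms, hns.comp hms, fun j hj => ?_⟩
    rcases Finset.mem_insert.1 hj with rfl | hj
    · exact hi
    · filter_upwards [hs j hj] with ω hω using hω.comp hms.tendsto_atTop

/-- Almost sure convergence of the nuisance functions of the densities `p n` to the baseline. -/
structure NuisanceTendsto (P : Measure Ω) (mA mL mW : MeasurableSpace Ω) (Z : Ω → ℝ)
    (p : ℕ → Ω → ℝ) : Prop where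
  density : ∀ᵐ ω ∂P, Tendsto (fun n => p n ω) atTop (𝓝 1)
  treatment : ∀ᵐ ω ∂P, Tendsto (fun n => (P[p n | mA]) ω) atTop (𝓝 1)
  covariate : ∀ᵐ ω ∂P, Tendsto (fun n => (P[p n | mL]) ω) atTop (𝓝 1)
  joint : ∀ᵐ ω ∂P, Tendsto (fun n => (P[p n | mW]) ω) atTop (𝓝 1)
  instrument_covariate : ∀ᵐ ω ∂P,
    Tendsto (fun n => (P[fun x => Z x * p n x | mL]) ω) atTop (𝓝 ((P[Z | mL]) ω))
  instrument_joint : ∀ᵐ ω ∂P,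
    Tendsto (fun n => (P[fun x => Z x * p n x | mW]) ω) atTop (𝓝 ((P[Z | mW]) ω))

theorem sqrt_bound {p : Ω → ℝ} (hp : IsRatio P p K) : ∀ᵐ ω ∂P, |√(p ω) - 1| ≤ K := by
  filter_upwards [hp.mem_Icc] with ω hω
  have hK := hp.one_le
  have h1 : √(p ω) ≤ K := by
    rw [Real.sqrt_le_left hp.pos.le]
    nlinarith [hω.2]
  have h2 := Real.sqrt_nonneg (p ω)
  rw [abs_le]
  constructor <;> linarith

namespace IsModel

variable (h : IsModel P mA mL mW Y Z B N)
include h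

theorem invKappa_tendsto {p : ℕ → Ω → ℝ} (hε : 0 < ε)
    (hκ : ∀ᵐ ω ∂P, ω ∈ N → ε ≤ |condKappa P mL mW Z (fun _ => 1) ω|)
    (hlim : NuisanceTendsto P mA mL mW Z p) :
    ∀ᵐ ω ∂P, Tendsto (fun n => invKappa P mL mW Z N (p n) ω) atTop
      (𝓝 (invKappa P mL mW Z N (fun _ => 1) ω)) := by
  filter_upwards [hκ, hlim.covariate, hlim.joint, hlim.instrument_covariate,
    hlim.instrument_joint] with ω h1 h2 h3 h4 h5
  by_cases hω : ω ∈ N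
  · simp only [invKappa, hω, Set.indicator_of_mem]
    refine Tendsto.inv₀ ?_ ?_
    · have := (h5.div h3 one_ne_zero).sub (h4.div h2 one_ne_zero)
      rw [condKappa, condRatio_one h.le, condRatio_one (h.leL.trans h.le)]
      simpa [condKappa, condRatio] using this
    · intro h0
      have := h1 hω
      rw [h0, abs_zero] at this
      linarith
  · simp [invKappa, hω]

theorem sub_condExp_tendsto {f : ℕ → Ω → ℝ} {g : Ω → ℝ} (hf : TendstoMeanSquare P f atTop g) :
    TendstoMeanSquare P (fun n ω => (Z ω - (P[Z | mL]) ω) * f n ω) atTop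
      (fun ω => (Z ω - (P[Z | mL]) ω) * g ω) := by
  refine TendstoMeanSquare.of_sub (h.sub_condExp_memLp hf.memLp_limit) ?_
  have := hf.sub_limit.bounded_mul_zero (u := fun _ ω => Z ω - (P[Z | mL]) ω) (C := B + B)
    (fun _ => h.integrable_Z.1.sub integrable_condExp.1) (fun _ => by
      filter_upwards [h.condExp_Z_bound (h.leL.trans h.le)] with ω hω
      exact (abs_sub _ _).trans (add_le_add (h.bound ω) hω))
  refine this.congr (fun n => Eventually.of_forall fun ω => ?_) EventuallyEq.rfl
  simp only [Pi.sub_apply]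
  ring

/-- In each term `p` enters only through multipliers of the fixed `L²` functions `V` and `μ`. These
multipliers are bounded uniformly in `n` and converge almost surely, so dominated convergence
applies; conditioning and multiplication by the bounded `Z - ρ` preserve the limit. -/
theorem gradAt_tendsto {p : ℕ → Ω → ℝ} (hε : 0 < ε)
    (hκ : ∀ᵐ ω ∂P, ω ∈ N → ε ≤ |condKappa P mL mW Z (fun _ => 1) ω|)
    (hp : ∀ n, IsRatio P (p n) K)
    (hκp : ∀ n, ∀ᵐ ω ∂P, ω ∈ N → ε ≤ |condKappa P mL mW Z (p n) ω|)
    (hlim : NuisanceTendsto P mA mL mW Z p) :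
    TendstoMeanSquare P (fun n => gradAt P mA mL mW Y Z N (p n)) atTop
      (gradAt P mA mL mW Y Z N fun _ => 1) := by
  have hL := h.leL.trans h.le
  have hA := h.leA.trans h.le
  have hV := h.residual_memLp hε hκ
  have hμ := h.condMu_memLp (isRatio_one (le_refl 1)) hε hκ
  have hR := h.invKappa_tendsto hε hκ hlim
  have hbm : ∀ n, Measurable[m0] (P[p n | mA]) := fun n =>
    stronglyMeasurable_condExp.measurable.mono hA le_rfl
  have hcm : ∀ n, Measurable[m0] (P[p n | mL]) := fun n =>
    stronglyMeasurable_condExp.measurable.mono hL le_rfl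
  have hem : ∀ n, Measurable[m0] (P[p n | mW]) := fun n =>
    stronglyMeasurable_condExp.measurable.mono h.le le_rfl
  have hRm : ∀ n, Measurable[m0] (invKappa P mL mW Z N (p n)) := fun n =>
    h.measurable_invKappa.mono h.le le_rfl
  have c1 := TendstoMeanSquare.mul_of_ae_tendsto (C := ε⁻¹ * K * K * K)
    (u := fun n ω => invKappa P mL mW Z N (p n) ω * (P[p n | mA]) ω * (P[p n | mL]) ω /
      (P[p n | mW]) ω) (v := invKappa P mL mW Z N fun _ => 1) hV
    (fun n => ((((hRm n).mul (hbm n)).mul (hcm n)).div (hem n)).aestronglyMeasurable)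
    (fun n => (hp n).weight_bound hA hL h.le hε (hκp n)) (by
      filter_upwards [hR, hlim.treatment, hlim.covariate, hlim.joint] with ω h1 h2 h3 h4
      have := ((h1.mul h2).mul h3).div h4 one_ne_zero
      simp only [mul_one, div_one] at this
      exact this)
  have c2 := TendstoMeanSquare.mul_of_ae_tendsto (C := ε⁻¹ * K * K * K)
    (u := fun n ω => invKappa P mL mW Z N (p n) ω * p n ω * (P[p n | mA]) ω /
      (P[p n | mW]) ω) (v := invKappa P mL mW Z N fun _ => 1) hV
    (fun n => ((((hRm n).mul (hp n).measurable).mul (hbm n)).div (hem n)).aestronglyMeasurable)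
    (fun n => (hp n).weight_bound' (mL := mL) hA h.le hε (hκp n)) (by
      filter_upwards [hR, hlim.treatment, hlim.density, hlim.joint] with ω h1 h2 h3 h4
      have := ((h1.mul h3).mul h2).div h4 one_ne_zero
      simp only [mul_one, div_one] at this
      exact this)
  have c3 := TendstoMeanSquare.mul_of_ae_tendsto (C := K)
    (u := fun n => P[p n | mL]) (v := fun _ => 1) hμ
    (fun n => (hcm n).aestronglyMeasurable) (fun n => by
      filter_upwards [(hp n).condExp_mem hL] with ω hω
      rw [abs_of_nonneg ((inv_pos.2 (hp n).pos).le.trans hω.1)]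
      exact hω.2) hlim.covariate
  have key := ((h.sub_condExp_tendsto (c1.add (c2.condExp mL).neg)).add (c3.condExp mA)).add
    (TendstoMeanSquare.const (hμ.condExp (m := mL) (by norm_num)))
  refine key.congr (fun n => Eventually.of_forall fun ω => ?_) (Eventually.of_forall fun ω => ?_)
  · simp only [gradAt, Pi.add_apply, Pi.neg_apply]
    ring
  · simp only [gradAt, Pi.add_apply, Pi.neg_apply, condExp_const hA, condExp_const hL,
      condExp_const h.le, mul_one, div_one]
    ring

theorem tendsto_weightedPsi_div {p : ℕ → Ω → ℝ} {t : ℕ → ℝ} {s : Ω → ℝ} (hε : 0 < ε)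
    (hκ : ∀ᵐ ω ∂P, ω ∈ N → ε ≤ |condKappa P mL mW Z (fun _ => 1) ω|)
    (hp : ∀ n, IsRatio P (p n) K)
    (hκp : ∀ n, ∀ᵐ ω ∂P, ω ∈ N → ε ≤ |condKappa P mL mW Z (p n) ω|)
    (hlim : NuisanceTendsto P mA mL mW Z p)
    (hs : TendstoMeanSquare P (fun n ω => (p n ω - 1) / t n) atTop s) :
    Tendsto (fun n => (weightedPsi P mA mL mW Y Z (p n) -
        weightedPsi P mA mL mW Y Z fun _ => 1) / t n) atTop
      (𝓝 (∫ ω, gradAt P mA mL mW Y Z N (fun _ => 1) ω * s ω ∂P)) := by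
  refine ((h.gradAt_tendsto hε hκ hp hκp hlim).integral_mul hs).congr fun n => ?_
  rw [h.weightedPsi_sub hε hκ (hp n) (hκp n), ← integral_div]
  simp only [mul_div_assoc]

theorem nuisanceTendsto {p : ℕ → Ω → ℝ} (hp : TendstoMeanSquare P p atTop fun _ => 1) :
    ∃ ns : ℕ → ℕ, StrictMono ns ∧ NuisanceTendsto P mA mL mW Z fun n => p (ns n) := by
  have hL := h.leL.trans h.le
  have hA := h.leA.trans h.le
  have hZ : TendstoMeanSquare P (fun n ω => Z ω * p n ω) atTop Z := by
    have hZ2 : MemLp Z 2 P := MemLp.of_bound h.integrable_Z.1 B (Eventually.of_forall h.bound)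
    refine TendstoMeanSquare.of_sub hZ2 ?_
    refine (hp.sub_limit.bounded_mul_zero (u := fun _ => Z) (fun _ => h.integrable_Z.1)
      (fun _ => Eventually.of_forall h.bound)).congr
      (fun n => Eventually.of_forall fun ω => ?_) EventuallyEq.rfl
    simp [mul_sub]
  -- The six sequences form one finite family so that a single subsequence serves them all.
  have hall : ∀ i : Fin 6, TendstoMeanSquare P
      ((![p, fun n => P[p n | mA], fun n => P[p n | mL], fun n => P[p n | mW],
        fun n => P[fun x => Z x * p n x | mL], fun n => P[fun x => Z x * p n x | mW]] :
          Fin 6 → ℕ → Ω → ℝ) i) atTop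
      ((![fun _ => 1, P[fun _ => 1 | mA], P[fun _ => 1 | mL], P[fun _ => 1 | mW], P[Z | mL],
        P[Z | mW]] : Fin 6 → Ω → ℝ) i) := by
    intro i
    fin_cases i
    · exact hp
    · exact hp.condExp mA
    · exact hp.condExp mL
    · exact hp.condExp mW
    · exact hZ.condExp mL
    · exact hZ.condExp mW
  obtain ⟨ns, hns, hc⟩ := exists_common_seq_tendsto_ae Finset.univ hall
  have c1 := hc 1 (Finset.mem_univ _)
  have c2 := hc 2 (Finset.mem_univ _)
  have c3 := hc 3 (Finset.mem_univ _)
  simp only [condExp_const hA, condExp_const hL, condExp_const h.le] at c1 c2 c3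
  exact ⟨ns, hns, hc 0 (Finset.mem_univ _), c1, c2, c3, hc 4 (Finset.mem_univ _),
    hc 5 (Finset.mem_univ _)⟩

/-- Along a path with uniformly bounded likelihood ratios which is differentiable in quadratic mean,
every sequence of parameters tending to `0` has a subsequence along which the difference quotients
of the density converge to the score in mean square and the nuisance functions converge almost
surely. -/
theorem exists_seq_tendsto_score {p : ℝ → Ω → ℝ} {s : Ω → ℝ} {S : Set ℝ}
    (hS : S ∈ 𝓝 (0 : ℝ)) (hp : ∀ t ∈ S, IsRatio P (p t) K) (hs : MemLp s 2 P)
    (hdqm : Tendsto (fun t : ℝ => (∫ ω, (√(p t ω) - 1 - t / 2 * s ω) ^ 2 ∂P) / t ^ 2)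
      (𝓝[≠] 0) (𝓝 0))
    {ns : ℕ → ℝ} (hns : Tendsto ns atTop (𝓝[≠] 0)) :
    ∃ ms : ℕ → ℕ, (∀ n, ns (ms n) ∈ S) ∧
      NuisanceTendsto P mA mL mW Z (fun n => p (ns (ms n))) ∧
      TendstoMeanSquare P (fun n ω => (p (ns (ms n)) ω - 1) / ns (ms n)) atTop s := by
  have hns0 : Tendsto ns atTop (𝓝 0) := hns.mono_right nhdsWithin_le_nhds
  have hev := (hns0.eventually_mem hS).and (hns.eventually self_mem_nhdsWithin)
  obtain ⟨n0, hn0⟩ := eventually_atTop.1 hev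
  -- Dropping `n0` terms makes every parameter nonzero and a member of `S`; the shift reappears in
  -- the final witness.
  set t : ℕ → ℝ := fun n => ns (n + n0) with ht
  have htlim : Tendsto t atTop (𝓝[≠] 0) := hns.comp (tendsto_add_atTop_nat n0)
  have htS : ∀ n, t n ∈ S := fun n => (hn0 (n + n0) (by omega)).1
  have htp : ∀ n, IsRatio P (p (t n)) K := fun n => hp _ (htS n)
  have ht0 : ∀ n, t n ≠ 0 := fun n => (hn0 (n + n0) (by omega)).2
  have hsq : ∀ n, AEStronglyMeasurable[m0] (fun ω => √(p (t n) ω) - 1) P := fun n =>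
    ((htp n).measurable.sqrt.sub_const 1).aestronglyMeasurable
  have hsq2 : ∀ n, MemLp (fun ω => √(p (t n) ω) - 1) 2 P := fun n =>
    MemLp.of_bound (hsq n) K (sqrt_bound (htp n))
  have hr : TendstoMeanSquare P (fun n ω => (√(p (t n) ω) - 1) / t n) atTop
      (fun ω => s ω / 2) := by
    refine TendstoMeanSquare.of_integral (fun n => ?_) ?_ ?_
    · simpa only [div_eq_inv_mul] using (hsq2 n).const_mul (t n)⁻¹
    · simpa only [div_eq_inv_mul] using hs.const_mul 2⁻¹
    · refine (hdqm.comp htlim).congr fun n => ?_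
      simp only [Function.comp_apply]
      rw [← integral_div]
      refine integral_congr_ae (Eventually.of_forall fun ω => ?_)
      have := ht0 n
      field_simp
  -- The quotient `(√p - 1) / t` converges in `L²`; multiply by `t → 0`.
  have hd0 : TendstoMeanSquare P (fun n ω => √(p (t n) ω) - 1) atTop 0 := by
    refine ⟨hsq2, MemLp.zero, ?_⟩
    have e : ∀ n, eLpNorm ((fun ω => √(p (t n) ω) - 1) - 0) 2 P =
        ENNReal.ofReal |t n| * eLpNorm (fun ω => (√(p (t n) ω) - 1) / t n) 2 P := by
      intro n
      have e1 : ((fun ω => √(p (t n) ω) - 1) - 0 : Ω → ℝ) =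
          t n • fun ω => (√(p (t n) ω) - 1) / t n := by
        ext ω
        simp [mul_div_cancel₀ _ (ht0 n)]
      rw [e1, eLpNorm_const_smul, Real.enorm_eq_ofReal_abs]
    simp_rw [e]
    have b1 : Tendsto (fun n => ENNReal.ofReal |t n|) atTop (𝓝 0) := by
      have := ENNReal.tendsto_ofReal ((htlim.mono_right nhdsWithin_le_nhds).abs)
      simpa using this
    have b2 : ∀ n, eLpNorm (fun ω => (√(p (t n) ω) - 1) / t n) 2 P ≤
        eLpNorm ((fun ω => (√(p (t n) ω) - 1) / t n) - fun ω => s ω / 2) 2 P +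
          eLpNorm (fun ω => s ω / 2) 2 P := by
      intro n
      have := eLpNorm_add_le (μ := P) (p := 2) ((hr.memLp n).sub hr.memLp_limit).1
        hr.memLp_limit.1 (by norm_num)
      simpa using this
    have b3 := ENNReal.Tendsto.mul b1 (Or.inr (by simpa using hr.memLp_limit.2.ne))
      (hr.tendsto.add_const (eLpNorm (fun ω => s ω / 2) 2 P)) (Or.inr ENNReal.zero_ne_top)
    rw [zero_mul] at b3
    exact tendsto_of_tendsto_of_tendsto_of_le_of_le tendsto_const_nhds b3 (fun _ => zero_le)
      fun n => mul_le_mul_right (b2 n) _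
  -- Factor `p - 1 = (√p + 1)(√p - 1)`; the first factor is bounded by `K + 2`.
  have hp1 : TendstoMeanSquare P (fun n => p (t n)) atTop fun _ => 1 := by
    refine TendstoMeanSquare.of_sub (memLp_const 1) ?_
    refine (hd0.bounded_mul_zero (u := fun n ω => √(p (t n) ω) + 1) (C := K + 2)
      (fun n => ((htp n).measurable.sqrt.add_const 1).aestronglyMeasurable) (fun n => ?_)).congr
      (fun n => ?_) EventuallyEq.rfl
    · filter_upwards [sqrt_bound (htp n)] with ω hω
      rw [abs_le] at hω ⊢
      constructor <;> linarith [Real.sqrt_nonneg (p (t n) ω)]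
    · filter_upwards [(htp n).mem_Icc] with ω hω
      have := Real.sq_sqrt ((inv_pos.2 (htp n).pos).le.trans hω.1)
      simp only [Pi.sub_apply]
      linear_combination this
  obtain ⟨ms, hms, hnuis⟩ := h.nuisanceTendsto hp1
  -- With `r = (√p - 1) / t`, the quotient is `2 r + (√p - 1)(r - s/2) + (√p - 1) s/2`. The second
  -- term vanishes in `L²` because `√p - 1` is bounded, the third by dominated convergence, which
  -- uses the almost sure limit of `p`.
  have hg : TendstoMeanSquare P (fun n ω => (p (t (ms n)) ω - 1) / t (ms n)) atTop s := by
    have hr' := hr.comp hms.tendsto_atTop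
    have c1 := hr'.sub_limit.bounded_mul_zero (u := fun n ω => √(p (t (ms n)) ω) - 1) (C := K)
      (fun n => hsq _) (fun n => sqrt_bound (htp _))
    have c2 := TendstoMeanSquare.mul_of_ae_tendsto (u := fun n ω => √(p (t (ms n)) ω) - 1)
      (v := fun _ => 0) (C := K) hr.memLp_limit (fun n => hsq _) (fun n => sqrt_bound (htp _)) (by
        filter_upwards [hnuis.density] with ω hω
        simpa using (hω.sqrt).sub_const 1)
    refine (((hr'.add hr').add c1).add c2).congr (fun n => ?_) (Eventually.of_forall fun ω => ?_)
    · filter_upwards [(htp (ms n)).mem_Icc] with ω hω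
      have := Real.sq_sqrt ((inv_pos.2 (htp (ms n)).pos).le.trans hω.1)
      have h0 := ht0 (ms n)
      simp only [Pi.add_apply, Pi.sub_apply]
      field_simp
      linear_combination 2 * this
    · simp
  exact ⟨fun n => ms n + n0, fun n => htS (ms n), hnuis, hg⟩

/-- Differentiability of the weighted functional along a path with uniformly bounded likelihood
ratios which is differentiable in quadratic mean. -/
theorem tendsto_weightedPsi_slope {p : ℝ → Ω → ℝ} {s : Ω → ℝ} {S : Set ℝ} (hε : 0 < ε)
    (hκ : ∀ᵐ ω ∂P, ω ∈ N → ε ≤ |condKappa P mL mW Z (fun _ => 1) ω|)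
    (hS : S ∈ 𝓝 (0 : ℝ)) (hp : ∀ t ∈ S, IsRatio P (p t) K)
    (hκp : ∀ t ∈ S, ∀ᵐ ω ∂P, ω ∈ N → ε ≤ |condKappa P mL mW Z (p t) ω|)
    (hs : MemLp s 2 P)
    (hdqm : Tendsto (fun t : ℝ => (∫ ω, (√(p t ω) - 1 - t / 2 * s ω) ^ 2 ∂P) / t ^ 2)
      (𝓝[≠] 0) (𝓝 0)) :
    Tendsto (fun t => (weightedPsi P mA mL mW Y Z (p t) -
        weightedPsi P mA mL mW Y Z fun _ => 1) / t) (𝓝[≠] 0)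
      (𝓝 (∫ ω, gradAt P mA mL mW Y Z N (fun _ => 1) ω * s ω ∂P)) := by
  -- Almost sure convergence is available only along subsequences; one for each sequence of
  -- parameters is enough.
  refine tendsto_of_subseq_tendsto fun ns hns => ?_
  obtain ⟨ms, hmS, hnuis, hg⟩ := h.exists_seq_tendsto_score hS hp hs hdqm hns
  exact ⟨ms, h.tendsto_weightedPsi_div hε hκ (fun n => hp _ (hmS n)) (fun n => hκp _ (hmS n))
    hnuis hg⟩

/-- Scores have mean zero. -/
theorem integral_score_eq_zero {p : ℝ → Ω → ℝ} {s : Ω → ℝ} {S : Set ℝ}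
    (hS : S ∈ 𝓝 (0 : ℝ)) (hp : ∀ t ∈ S, IsRatio P (p t) K) (hp1 : ∀ t ∈ S, ∫ ω, p t ω ∂P = 1)
    (hs : MemLp s 2 P)
    (hdqm : Tendsto (fun t : ℝ => (∫ ω, (√(p t ω) - 1 - t / 2 * s ω) ^ 2 ∂P) / t ^ 2)
      (𝓝[≠] 0) (𝓝 0)) : ∫ ω, s ω ∂P = 0 := by
  obtain ⟨ns, hns⟩ := exists_seq_tendsto (𝓝[≠] (0 : ℝ))
  obtain ⟨ms, hmS, -, hg⟩ := h.exists_seq_tendsto_score hS hp hs hdqm hns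
  have h1 := hg.integral_mul (TendstoMeanSquare.const (memLp_const (1 : ℝ)))
  simp only [mul_one] at h1
  -- Each difference quotient `(p - 1) / t` already has mean zero.
  refine tendsto_nhds_unique h1 (tendsto_const_nhds.congr fun n => ?_)
  rw [integral_div, integral_sub (hp _ (hmS n)).integrable (integrable_const 1), hp1 _ (hmS n)]
  simp

/-- The baseline gradient has mean twice the weighted functional. -/
theorem integral_gradAt_one (hε : 0 < ε)
    (hκ : ∀ᵐ ω ∂P, ω ∈ N → ε ≤ |condKappa P mL mW Z (fun _ => 1) ω|) :
    MemLp (gradAt P mA mL mW Y Z N fun _ => 1) 2 P ∧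
    ∫ ω, gradAt P mA mL mW Y Z N (fun _ => 1) ω ∂P =
      2 * weightedPsi P mA mL mW Y Z fun _ => 1 := by
  have hL := h.leL.trans h.le
  have hA := h.leA.trans h.le
  have hV := h.residual_memLp hε hκ
  have hμ := h.condMu_memLp (isRatio_one (le_refl 1)) hε hκ
  have hRm : Measurable[mW] (invKappa P mL mW Z N fun _ => 1) := h.measurable_invKappa
  have hRV : MemLp (fun ω => invKappa P mL mW Z N (fun _ => 1) ω * residual P mL mW Y Z ω) 2 P :=
    MemLp.bounded_mul hV (hRm.mono h.le le_rfl).aestronglyMeasurable (invKappa_bound hε hκ)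
  set R := invKappa P mL mW Z N fun _ => 1 with hR
  set V := residual P mL mW Y Z with hVdef
  set μ := condMu P mL mW Y Z fun _ => 1 with hμdef
  have hE : MemLp (P[fun ω => R ω * V ω | mL]) 2 P := hRV.condExp (by norm_num)
  have i1 := h.sub_condExp_memLp hRV
  have i2 := h.sub_condExp_memLp hE
  have i3 : MemLp (P[μ | mA]) 2 P := hμ.condExp (by norm_num)
  have i4 : MemLp (P[μ | mL]) 2 P := hμ.condExp (by norm_num)
  have e : gradAt P mA mL mW Y Z N (fun _ => 1) = fun ω =>
      (Z ω - (P[Z | mL]) ω) * (R ω * V ω) - (Z ω - (P[Z | mL]) ω) *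
        (P[fun ω => R ω * V ω | mL]) ω + (P[μ | mA]) ω + (P[μ | mL]) ω := by
    ext ω
    simp only [gradAt, condExp_const hA, condExp_const hL, condExp_const h.le, mul_one, div_one,
      one_mul]
    rw [← hμdef, mul_sub]
  have hVZ : Integrable (fun ω => V ω * (Z ω - (P[Z | mL]) ω)) P := by
    simpa only [mul_comm] using (h.sub_condExp_memLp hV).integrable (by norm_num)
  have hZρ : MemLp (fun ω => Z ω - (P[Z | mL]) ω) 2 P := by
    simpa using h.sub_condExp_memLp (memLp_const (1 : ℝ))
  -- `R` is `mW`-measurable, so conditioning on `mW` reduces this to the moment condition.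
  have z1 : ∫ ω, (Z ω - (P[Z | mL]) ω) * (R ω * V ω) ∂P = 0 := by
    have z2 : ∫ ω, (Z ω - (P[Z | mL]) ω) * (R ω * V ω) ∂P =
        ∫ ω, R ω * (V ω * (Z ω - (P[Z | mL]) ω)) ∂P :=
      integral_congr_ae (Eventually.of_forall fun ω => by ring)
    rw [z2, ← integral_mul_condExp_of_aestronglyMeasurable h.le
      hRm.stronglyMeasurable.aestronglyMeasurable hVZ
      (hVZ.bdd_mul (hRm.mono h.le le_rfl).aestronglyMeasurable (invKappa_bound hε hκ))]
    rw [integral_eq_zero_of_ae]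
    filter_upwards [h.condExp_residual_mul_baseline hε hκ] with ω hω
    rw [hω]
    simp
  have z3 : ∫ ω, (Z ω - (P[Z | mL]) ω) * (P[fun ω => R ω * V ω | mL]) ω ∂P = 0 := by
    -- The conditioning moves onto `Z - ρ`, whose conditional mean given `mL` is zero.
    rw [integral_mul_condExp_comm hL hZρ hRV, integral_eq_zero_of_ae]
    filter_upwards [condExp_sub (m := mL) h.integrable_Z
      (integrable_condExp (m := mL) (f := Z))] with ω hω
    have hω' : (P[fun ω => Z ω - (P[Z | mL]) ω | mL]) ω = 0 := by
      refine hω.trans ?_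
      rw [Pi.sub_apply, condExp_of_stronglyMeasurable hL stronglyMeasurable_condExp
        integrable_condExp, sub_self]
    rw [hω']
    simp
  rw [e]
  refine ⟨((i1.sub i2).add i3).add i4, ?_⟩
  rw [integral_sub_add_add (i1.integrable (by norm_num)) (i2.integrable (by norm_num))
    (i3.integrable (by norm_num)) (i4.integrable (by norm_num)), z1, z3, integral_condExp hA,
    integral_condExp hL]
  simp only [weightedPsi, condExp_const hA, condExp_const hL, mul_one, ← hμdef]
  ring

end IsModel

end Limits

/-! ## Densities, images and products of measures -/

section Densities

variable {α β : Type*} {mα : MeasurableSpace α} {mβ : MeasurableSpace β} {μ : Measure α}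

theorem integral_withDensity_ofReal {d : α → ℝ} (hd : Measurable d) (h0 : ∀ᵐ x ∂μ, 0 ≤ d x)
    (f : α → ℝ) :
    ∫ x, f x ∂(μ.withDensity fun x => ENNReal.ofReal (d x)) = ∫ x, d x * f x ∂μ := by
  rw [integral_withDensity_eq_integral_toReal_smul hd.ennreal_ofReal
    (Eventually.of_forall fun _ => ENNReal.ofReal_lt_top)]
  refine integral_congr_ae ?_
  filter_upwards [h0] with x hx
  rw [ENNReal.toReal_ofReal hx, smul_eq_mul]

theorem integrable_withDensity_ofReal {d : α → ℝ} (hd : Measurable d) (h0 : ∀ᵐ x ∂μ, 0 ≤ d x)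
    {f : α → ℝ} :
    Integrable f (μ.withDensity fun x => ENNReal.ofReal (d x)) ↔
      Integrable (fun x => d x * f x) μ := by
  rw [integrable_withDensity_iff_integrable_smul' hd.ennreal_ofReal
    (Eventually.of_forall fun _ => ENNReal.ofReal_lt_top)]
  refine integrable_congr ?_
  filter_upwards [h0] with x hx
  rw [ENNReal.toReal_ofReal hx, smul_eq_mul]

theorem map_withDensity_comp {W : α → β} (hW : Measurable W) {g : β → ℝ≥0∞} (hg : Measurable g) :
    (μ.withDensity fun x => g (W x)).map W = (μ.map W).withDensity g := by
  ext s hs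
  rw [Measure.map_apply hW hs, withDensity_apply _ (hW hs), withDensity_apply _ hs,
    setLIntegral_map hs hg hW]

/-- Bayes' formula for the conditional expectation under a change of measure. -/
theorem condExp_withDensity {m : MeasurableSpace α} (hm : m ≤ mα) [IsProbabilityMeasure μ]
    {p : α → ℝ} {K : ℝ} (hp : IsRatio μ p K)
    [IsProbabilityMeasure (μ.withDensity fun x => ENNReal.ofReal (p x))]
    {f : α → ℝ} (hf : Integrable f μ) :
    (μ.withDensity fun x => ENNReal.ofReal (p x))[f | m] =ᵐ[μ] condRatio μ m p f := by
  have h0 : ∀ᵐ x ∂μ, 0 ≤ p x := by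
    filter_upwards [hp.mem_Icc] with x hx using (inv_pos.2 hp.pos).le.trans hx.1
  set ν := μ.withDensity fun x => ENNReal.ofReal (p x) with hν
  set r := ν[f | m] with hr
  have hrν : Integrable r ν := integrable_condExp
  have hrm : StronglyMeasurable[m] r := stronglyMeasurable_condExp
  have hfp : Integrable (fun x => f x * p x) μ := hp.mul_integrable hf
  have hfν : Integrable f ν := (integrable_withDensity_ofReal hp.measurable h0).2 (by
    simpa only [mul_comm] using hfp)
  have hrp : Integrable (fun x => r x * p x) μ := by
    simpa only [mul_comm] using (integrable_withDensity_ofReal hp.measurable h0).1 hrν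
  -- Pulling out, the left side is `μ[r p | m]`. On `m`-measurable sets the integrals of `r p` and
  -- `f p` under `μ` are those of `r` and `f` under `ν`, which agree.
  have h1 : (fun x => r x * (μ[p | m]) x) =ᵐ[μ] μ[fun x => f x * p x | m] := by
    have h2 := condExp_mul_of_stronglyMeasurable_left hrm hrp hp.integrable
    refine EventuallyEq.trans (h2.symm : _ =ᵐ[μ] μ[r * p | m]) ?_
    refine ae_eq_condExp_of_forall_setIntegral_eq hm hfp
      (fun s _ _ => integrable_condExp.integrableOn) (fun s hs _ => ?_)
      stronglyMeasurable_condExp.aestronglyMeasurable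
    have hrp' : Integrable (r * p) μ := hrp
    rw [setIntegral_condExp hm hrp' hs]
    have h3 := setIntegral_condExp hm hfν hs
    rw [← integral_indicator (hm s hs), ← integral_indicator (hm s hs),
      integral_withDensity_ofReal hp.measurable h0,
      integral_withDensity_ofReal hp.measurable h0] at h3
    rw [← integral_indicator (hm s hs), ← integral_indicator (hm s hs)]
    refine Eq.trans (integral_congr_ae (Eventually.of_forall fun x => ?_))
      (h3.trans (integral_congr_ae (Eventually.of_forall fun x => ?_)))
    all_goals
      by_cases hx : x ∈ s
      · simp [hx, mul_comm, hr]
      · simp [hx]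
  filter_upwards [h1, hp.condExp_mem hm] with x h2 h3
  rw [condRatio, ← h2, mul_div_cancel_right₀ _ ((inv_pos.2 hp.pos).trans_le h3.1).ne']

/-- If the product of the marginal laws of `W₁` and `W₂` has density `d` with respect to their joint
law, then conditioning `d f(W₁, W₂)` on `W₁` integrates out `W₂` under its marginal law. -/
theorem condExp_mul_prod_density {γ : Type*} {mγ : MeasurableSpace γ} [IsProbabilityMeasure μ]
    {W₁ : α → β} {W₂ : α → γ} (h₁ : Measurable W₁) (h₂ : Measurable W₂) {d : α → ℝ}
    (hd : Measurable d) (h0 : ∀ᵐ x ∂μ, 0 ≤ d x)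
    (hprod : (μ.map W₁).prod (μ.map W₂) =
      (μ.withDensity fun x => ENNReal.ofReal (d x)).map fun x => (W₁ x, W₂ x))
    {f : β × γ → ℝ} (hf : Measurable f) (hint : Integrable (fun x => d x * f (W₁ x, W₂ x)) μ) :
    (fun x => ∫ c, f (W₁ x, c) ∂(μ.map W₂)) =ᵐ[μ]
      μ[fun x => d x * f (W₁ x, W₂ x) | mβ.comap W₁] := by
  have : IsProbabilityMeasure (μ.map W₁) := Measure.isProbabilityMeasure_map h₁.aemeasurable
  have : IsProbabilityMeasure (μ.map W₂) := Measure.isProbabilityMeasure_map h₂.aemeasurable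
  have h12 : Measurable fun x => (W₁ x, W₂ x) := h₁.prodMk h₂
  have hfprod : Integrable f ((μ.map W₁).prod (μ.map W₂)) := by
    rw [hprod, integrable_map_measure hf.aestronglyMeasurable h12.aemeasurable]
    exact (integrable_withDensity_ofReal hd h0).2 hint
  have hgm : StronglyMeasurable fun b => ∫ c, f (b, c) ∂(μ.map W₂) :=
    hf.stronglyMeasurable.integral_prod_right'
  have hgint : Integrable (fun x => ∫ c, f (W₁ x, c) ∂(μ.map W₂)) μ :=
    (integrable_map_measure hgm.aestronglyMeasurable h₁.aemeasurable).1 hfprod.integral_prod_left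
  refine ae_eq_condExp_of_forall_setIntegral_eq h₁.comap_le hint
    (fun s _ _ => hgint.integrableOn) ?_
    (hgm.comp_measurable (Measurable.of_comap_le le_rfl)).aestronglyMeasurable
  rintro _ ⟨S, hS, rfl⟩ -
  have e1 : ∫ x in W₁ ⁻¹' S, (∫ c, f (W₁ x, c) ∂(μ.map W₂)) ∂μ =
      ∫ b in S, (∫ c, f (b, c) ∂(μ.map W₂)) ∂(μ.map W₁) :=
    (setIntegral_map hS hgm.aestronglyMeasurable h₁.aemeasurable).symm
  have hSm : MeasurableSet (Prod.fst ⁻¹' S : Set (β × γ)) := measurable_fst hS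
  have e2 : ∫ b in S, (∫ c, f (b, c) ∂(μ.map W₂)) ∂(μ.map W₁) =
      ∫ z, (Prod.fst ⁻¹' S).indicator f z ∂((μ.map W₁).prod (μ.map W₂)) := by
    rw [integral_prod _ (hfprod.indicator hSm), ← integral_indicator hS]
    refine integral_congr_ae (Eventually.of_forall fun b => ?_)
    by_cases hb : b ∈ S
    · simp [hb, Set.indicator]
    · simp [hb, Set.indicator]
  rw [e1, e2, hprod, integral_map h12.aemeasurable (hf.indicator hSm).aestronglyMeasurable,
    integral_withDensity_ofReal hd h0, ← integral_indicator (h₁ hS)]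
  refine integral_congr_ae (Eventually.of_forall fun x => ?_)
  by_cases hx : W₁ x ∈ S
  · simp [hx, Set.indicator]
  · simp [hx, Set.indicator]

theorem ae_map_iff_of_ac {κ : Measure β} {W : α → β} (hW : Measurable W)
    (h1 : μ.map W ≪ κ) (h2 : κ ≪ μ.map W) {q : β → Prop} (hq : MeasurableSet {b | q b}) :
    (∀ᵐ b ∂κ, q b) ↔ ∀ᵐ x ∂μ, q (W x) :=
  ⟨fun h => (ae_map_iff hW.aemeasurable hq).1 (h1.ae_le h),
    fun h => h2.ae_le ((ae_map_iff hW.aemeasurable hq).2 h)⟩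

/-- Two-sided domination yields a bounded likelihood ratio. -/
theorem exists_isRatio {ν : Measure α} [IsProbabilityMeasure μ] [IsProbabilityMeasure ν]
    {K : ℝ≥0} (h1 : ν ≤ K • μ) (h2 : μ ≤ K • ν) :
    IsRatio μ (fun x => (ν.rnDeriv μ x).toReal) K ∧
      ν = μ.withDensity fun x => ENNReal.ofReal ((ν.rnDeriv μ x).toReal) := by
  have hac : ν ≪ μ := (Measure.absolutelyContinuous_of_le h1).trans
    (Measure.smul_absolutelyContinuous)
  have hlt := Measure.rnDeriv_lt_top ν μ
  have hwd := Measure.withDensity_rnDeriv_eq ν μ hac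
  -- Compare total masses.
  have hK1 : (1 : ℝ≥0) ≤ K := by
    have := h1 Set.univ
    simp only [measure_univ, Measure.smul_apply] at this
    rw [ENNReal.smul_def, smul_eq_mul, mul_one] at this
    exact_mod_cast this
  have hK0 : (0 : ℝ) < K := by exact_mod_cast lt_of_lt_of_le one_pos hK1
  have hup : ∀ᵐ x ∂μ, ν.rnDeriv μ x ≤ K := by
    refine ae_le_of_forall_setLIntegral_le_of_sigmaFinite (Measure.measurable_rnDeriv ν μ)
      fun s hs _ => ?_
    rw [Measure.setLIntegral_rnDeriv hac, setLIntegral_const]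
    exact h1 s
  have hlow : ∀ᵐ x ∂μ, 1 ≤ K * ν.rnDeriv μ x := by
    refine ae_le_of_forall_setLIntegral_le_of_sigmaFinite measurable_const
      fun s hs _ => ?_
    rw [lintegral_const_mul _ (Measure.measurable_rnDeriv ν μ), Measure.setLIntegral_rnDeriv hac,
      setLIntegral_const, one_mul]
    exact h2 s
  refine ⟨⟨(Measure.measurable_rnDeriv ν μ).ennreal_toReal, by exact_mod_cast hK1, ?_⟩, ?_⟩
  · filter_upwards [hup, hlow, hlt] with x h3 h4 h5
    refine ⟨?_, ?_⟩
    · have h6 := ENNReal.toReal_mono (ENNReal.mul_ne_top ENNReal.coe_ne_top h5.ne) h4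
      rw [ENNReal.toReal_one, ENNReal.toReal_mul, ENNReal.coe_toReal] at h6
      rw [inv_le_iff_one_le_mul₀' hK0]
      exact h6
    · simpa using ENNReal.toReal_mono ENNReal.coe_ne_top h3
  · conv_lhs => rw [← hwd]
    refine withDensity_congr_ae ?_
    filter_upwards [hlt] with x hx
    rw [ENNReal.ofReal_toReal hx.ne]

end Densities

/-! ## Regression functions -/

section Regression

variable {Ω β : Type*} [MeasurableSpace Ω] [mβ : MeasurableSpace β]

theorem measurable_regression (P : ProbabilityMeasure Ω) (f : Ω → ℝ) (W : Ω → β) :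
    Measurable (regression P f W) :=
  ((stronglyMeasurable_id.comp_measurable measurable_snd).integral_condDistrib
    (f := fun z : β × ℝ => z.2)).measurable

theorem regression_comp_ae_eq (P : ProbabilityMeasure Ω) {f : Ω → ℝ} {W : Ω → β}
    (hW : Measurable W) (hf : Integrable f (P : Measure Ω)) :
    (fun ω => regression P f W (W ω)) =ᵐ[(P : Measure Ω)] (P : Measure Ω)[f | mβ.comap W] :=
  (condExp_ae_eq_integral_condDistrib' hW hf).symm

/-- Bayes' formula for regression functions. As `p` is positive, `P ≪ Q`, and the version defined
`Q`-almost everywhere can be read under `P`. -/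
theorem regression_comp_ae_eq_condRatio {P Q : ProbabilityMeasure Ω} {p : Ω → ℝ} {K : ℝ}
    (hp : IsRatio (P : Measure Ω) p K)
    (hQ : (Q : Measure Ω) = (P : Measure Ω).withDensity fun x => ENNReal.ofReal (p x))
    {f : Ω → ℝ} {W : Ω → β} (hW : Measurable W) (hf : Integrable f (P : Measure Ω)) :
    (fun ω => regression Q f W (W ω)) =ᵐ[(P : Measure Ω)]
      condRatio (P : Measure Ω) (mβ.comap W) p f := by
  have hprob : IsProbabilityMeasure
      ((P : Measure Ω).withDensity fun x => ENNReal.ofReal (p x)) := hQ ▸ inferInstance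
  have h0 : ∀ᵐ x ∂(P : Measure Ω), 0 < p x := by
    filter_upwards [hp.mem_Icc] with x hx using (inv_pos.2 hp.pos).trans_le hx.1
  have h1 := condExp_withDensity hW.comap_le hp hf
  rw [← hQ] at h1
  have hac : (P : Measure Ω) ≪ (Q : Measure Ω) := by
    rw [hQ]
    refine withDensity_absolutelyContinuous' hp.measurable.ennreal_ofReal.aemeasurable ?_
    filter_upwards [h0] with x hx
    exact (ENNReal.ofReal_pos.2 hx).ne'
  have hfQ : Integrable f (Q : Measure Ω) := by
    rw [hQ, integrable_withDensity_ofReal hp.measurable (h0.mono fun _ hx => hx.le)]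
    simpa only [mul_comm] using hp.mul_integrable hf
  exact (hac.ae_eq (regression_comp_ae_eq Q hW hfQ)).trans h1

/-- On the events `W ⁻¹' s`, the integrals of `p` and of its conditional expectation given `W`
coincide. -/
theorem map_withDensity_eq_regression (P : ProbabilityMeasure Ω) {p : Ω → ℝ} {K : ℝ}
    (hp : IsRatio (P : Measure Ω) p K) {W : Ω → β} (hW : Measurable W) :
    ((P : Measure Ω).withDensity fun x => ENNReal.ofReal (p x)).map W =
      ((P : Measure Ω).map W).withDensity fun b => ENNReal.ofReal (regression P p W b) := by
  rw [← map_withDensity_comp hW (measurable_regression P p W).ennreal_ofReal]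
  ext s hs
  have hK := inv_pos.2 hp.pos
  rw [Measure.map_apply hW hs, Measure.map_apply hW hs, withDensity_apply _ (hW hs),
    withDensity_apply _ (hW hs),
    ← ofReal_integral_eq_lintegral_ofReal hp.integrable.integrableOn (ae_restrict_of_ae (by
      filter_upwards [hp.mem_Icc] with x hx using hK.le.trans hx.1)),
    lintegral_congr_ae (g := fun x => ENNReal.ofReal (((P : Measure Ω)[p | mβ.comap W]) x))
      (ae_restrict_of_ae (by
        filter_upwards [regression_comp_ae_eq P hW hp.integrable] with x hx
        exact congrArg ENNReal.ofReal hx)),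
    ← ofReal_integral_eq_lintegral_ofReal integrable_condExp.integrableOn (ae_restrict_of_ae (by
      filter_upwards [hp.condExp_mem hW.comap_le] with x hx using hK.le.trans hx.1)),
    setIntegral_condExp hW.comap_le hp.integrable ⟨s, hs, rfl⟩]

end Regression

/-! ## The functional and its influence function in terms of conditional expectations -/

section Bridge

theorem condRatio_mul {Ω : Type*} {m0 : MeasurableSpace Ω} {μ : Measure Ω} {m : MeasurableSpace Ω}
    {K : ℝ} {p w f : Ω → ℝ} [IsProbabilityMeasure μ] (hp : IsRatio μ p K) (hw : Measurable[m] w)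
    (hf : Integrable f μ) (hwf : Integrable (fun x => w x * f x) μ) :
    condRatio μ m p (fun x => w x * f x) =ᵐ[μ] fun x => w x * condRatio μ m p f x := by
  have h1 : Integrable (fun x => w x * (f x * p x)) μ := by
    simpa only [mul_assoc] using hp.mul_integrable hwf
  filter_upwards [condExp_mul_of_stronglyMeasurable_left hw.stronglyMeasurable h1
    (hp.mul_integrable hf)] with x hx
  have hx' : (μ[fun x => w x * f x * p x | m]) x = w x * (μ[fun x => f x * p x | m]) x := by
    simp only [mul_assoc]
    exact hx
  rw [condRatio, condRatio, hx', mul_div_assoc]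

/-- This lets the weight `δ q` be absorbed into the outcome: both terms of the numerator carry the
outcome once, and the denominator does not involve it. -/
theorem condMu_mul {Ω : Type*} {m0 : MeasurableSpace Ω} {μ : Measure Ω}
    {mL mW : MeasurableSpace Ω}
    {K : ℝ} {p w Y Z : Ω → ℝ} [IsProbabilityMeasure μ] (hp : IsRatio μ p K) (hw : Measurable[mW] w)
    (hY : Integrable Y μ) (hwY : Integrable (fun x => w x * Y x) μ)
    (hYZ : Integrable (fun x => Y x * Z x) μ)
    (hwYZ : Integrable (fun x => w x * (Y x * Z x)) μ) :
    condMu μ mL mW (fun x => w x * Y x) Z p =ᵐ[μ] fun x => w x * condMu μ mL mW Y Z p x := by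
  filter_upwards [condRatio_mul hp hw hY hwY, condRatio_mul hp hw hYZ hwYZ] with x h1 h2
  simp only [condMu, mul_assoc, h1, h2]
  rw [← mul_div_assoc, mul_sub]

variable {𝓛 𝓩 : Type*} [m𝓛 : MeasurableSpace 𝓛] [MeasurableSpace 𝓩]

theorem measurable_obsL : Measurable (obsL : Obs 𝓛 𝓩 → 𝓛) := measurable_fst

theorem measurable_obsZ : Measurable (obsZ : Obs 𝓛 𝓩 → 𝓩) := measurable_fst.comp measurable_snd

theorem measurable_obsA : Measurable (obsA : Obs 𝓛 𝓩 → ℝ) :=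
  measurable_fst.comp (measurable_snd.comp measurable_snd)

theorem measurable_obsAL : Measurable (obsAL : Obs 𝓛 𝓩 → ℝ × 𝓛) :=
  measurable_obsA.prodMk measurable_obsL

theorem measurable_obsZpi {π : 𝓩 × 𝓛 → ℝ} (hπ : Measurable π) :
    Measurable (obsZpi π : Obs 𝓛 𝓩 → ℝ) :=
  hπ.comp (measurable_obsZ.prodMk measurable_obsL)

/-- The σ-algebra generated by the covariates. -/
abbrev sigmaL (𝓛 𝓩 : Type*) [m𝓛 : MeasurableSpace 𝓛] : MeasurableSpace (Obs 𝓛 𝓩) :=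
  m𝓛.comap obsL

/-- The σ-algebra generated by the treatment. -/
abbrev sigmaA (𝓛 𝓩 : Type*) : MeasurableSpace (Obs 𝓛 𝓩) :=
  MeasurableSpace.comap obsA inferInstance

/-- The σ-algebra generated by the treatment and the covariates. -/
abbrev sigmaAL (𝓛 𝓩 : Type*) [MeasurableSpace 𝓛] : MeasurableSpace (Obs 𝓛 𝓩) :=
  MeasurableSpace.comap obsAL inferInstance

theorem measurable_sigmaAL_comp {f : ℝ × 𝓛 → ℝ} (hf : Measurable f) :
    Measurable[sigmaAL 𝓛 𝓩] (fun o : Obs 𝓛 𝓩 => f (obsA o, obsL o)) :=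
  hf.comp (comap_measurable obsAL)

theorem sigmaL_le_sigmaAL : sigmaL 𝓛 𝓩 ≤ sigmaAL 𝓛 𝓩 := by
  have h : Measurable[sigmaAL 𝓛 𝓩] (obsL : Obs 𝓛 𝓩 → 𝓛) :=
    measurable_snd.comp (comap_measurable (obsAL : Obs 𝓛 𝓩 → ℝ × 𝓛))
  exact h.comap_le

theorem sigmaA_le_sigmaAL : sigmaA 𝓛 𝓩 ≤ sigmaAL 𝓛 𝓩 := by
  have h : Measurable[sigmaAL 𝓛 𝓩] (obsA : Obs 𝓛 𝓩 → ℝ) :=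
    (measurable_fst : Measurable (Prod.fst : ℝ × 𝓛 → ℝ)).comp (comap_measurable obsAL)
  exact h.comap_le

variable {P Q : ProbabilityMeasure (Obs 𝓛 𝓩)}

instance : IsProbabilityMeasure (lawL P) :=
  Measure.isProbabilityMeasure_map measurable_obsL.aemeasurable

instance : IsProbabilityMeasure (lawA P) :=
  Measure.isProbabilityMeasure_map measurable_obsA.aemeasurable

instance : IsProbabilityMeasure (lawAL P) :=
  Measure.isProbabilityMeasure_map measurable_obsAL.aemeasurable

theorem measurable_deltaFn : Measurable fun x : ℝ × 𝓛 => deltaFn P x.1 x.2 :=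
  ((Measure.measurable_rnDeriv _ _).ennreal_toReal.comp measurable_fst).div
    (Measure.measurable_rnDeriv (lawAL P) (volume.prod (lawL P))).ennreal_toReal

theorem deltaFn_nonneg (a : ℝ) (l : 𝓛) : 0 ≤ deltaFn P a l :=
  div_nonneg ENNReal.toReal_nonneg ENNReal.toReal_nonneg

theorem measurable_kappaFn (π : 𝓩 × 𝓛 → ℝ) : Measurable fun x : ℝ × 𝓛 => kappaFn P π x.1 x.2 :=
  (measurable_regression P _ obsAL).sub ((measurable_regression P _ obsL).comp measurable_snd)

theorem measurable_muFn (π : 𝓩 × 𝓛 → ℝ) : Measurable fun x : ℝ × 𝓛 => muFn P π x.1 x.2 :=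
  ((measurable_regression P _ obsAL).sub ((measurable_regression P _ obsAL).mul
    ((measurable_regression P _ obsL).comp measurable_snd))).div (measurable_kappaFn π)

theorem measurable_etaFn : Measurable fun x : ℝ × 𝓛 => etaFn P x.1 x.2 :=
  measurable_regression P _ obsAL

theorem lawA_absolutelyContinuous (hdens : lawAL P ≪ volume.prod (lawL P)) :
    lawA P ≪ volume := by
  refine Measure.AbsolutelyContinuous.mk fun s hs h0 => ?_
  have h1 : (volume.prod (lawL P)) (s ×ˢ Set.univ) = 0 := by
    rw [Measure.prod_prod, h0, zero_mul]
  have h2 := hdens h1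
  rw [lawAL, Measure.map_apply measurable_obsAL (hs.prod MeasurableSet.univ)] at h2
  rw [lawA, Measure.map_apply measurable_obsA hs]
  refine measure_mono_null (fun o ho => ?_) h2
  exact ⟨ho, trivial⟩

theorem prod_law_eq_withDensity (hdens : lawAL P ≪ volume.prod (lawL P)) :
    (lawA P).prod (lawL P) =
      (volume.prod (lawL P)).withDensity fun z => (lawA P).rnDeriv volume z.1 := by
  have h := prod_withDensity_left (μ := (volume : Measure ℝ)) (ν := lawL P)
    (Measure.measurable_rnDeriv (lawA P) volume)
  rwa [Measure.withDensity_rnDeriv_eq _ _ (lawA_absolutelyContinuous hdens)] at h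

/-- The product of the marginal laws has density `δ(A, L)` with respect to the joint law. -/
theorem prod_law_eq_map (hdens : lawAL P ≪ volume.prod (lawL P))
    (hpos : ∀ᵐ x ∂((lawA P).prod (lawL P)), 0 < densAgivenL P x.1 x.2) :
    (lawA P).prod (lawL P) = ((P : Measure (Obs 𝓛 𝓩)).withDensity
      fun o => ENNReal.ofReal (deltaFn P (obsA o) (obsL o))).map obsAL := by
  have hr := Measure.measurable_rnDeriv (lawAL P) (volume.prod (lawL P))
  have hδ : Measurable fun x : ℝ × 𝓛 => ENNReal.ofReal (deltaFn P x.1 x.2) :=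
    measurable_deltaFn.ennreal_ofReal
  have e1 := map_withDensity_comp (μ := (P : Measure (Obs 𝓛 𝓩))) measurable_obsAL hδ
  have hA : Measurable fun z : ℝ × 𝓛 => (lawA P).rnDeriv volume z.1 :=
    (Measure.measurable_rnDeriv _ _).comp measurable_fst
  have hpos' := hpos
  rw [prod_law_eq_withDensity hdens, ae_withDensity_iff hA] at hpos'
  have hlt : ∀ᵐ z ∂(volume.prod (lawL P)), (lawA P).rnDeriv volume z.1 < ∞ :=
    Measure.quasiMeasurePreserving_fst.ae (Measure.rnDeriv_lt_top (lawA P) volume)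
  have e2 : (lawAL P).withDensity (fun x => ENNReal.ofReal (deltaFn P x.1 x.2)) =
      (volume.prod (lawL P)).withDensity ((lawAL P).rnDeriv (volume.prod (lawL P)) *
        fun x => ENNReal.ofReal (deltaFn P x.1 x.2)) := by
    rw [withDensity_mul _ hr hδ, Measure.withDensity_rnDeriv_eq _ _ hdens]
  rw [prod_law_eq_withDensity hdens]
  refine Eq.trans ?_ (e1.trans e2).symm
  refine withDensity_congr_ae ?_
  filter_upwards [hpos', hlt, Measure.rnDeriv_lt_top (lawAL P) (volume.prod (lawL P))]
    with z h1 h2 h3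
  rw [Pi.mul_apply]
  -- Where `p_A = 0` both densities vanish. Elsewhere `p_{A|L} > 0`, so `p_{A|L} δ = p_A` holds
  -- without a division by zero.
  by_cases h0 : (lawA P).rnDeriv volume z.1 = 0
  · simp [deltaFn, densA, h0]
  · have h4 := h1 h0
    have h5 : (lawAL P).rnDeriv (volume.prod (lawL P)) z =
        ENNReal.ofReal (densAgivenL P z.1 z.2) := (ENNReal.ofReal_toReal h3.ne).symm
    rw [h5, ← ENNReal.ofReal_mul h4.le, deltaFn, mul_div_cancel₀ _ h4.ne', densA,
      ENNReal.ofReal_toReal h2.ne]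

/-- The product law has density `p_A(a)` with respect to `da ⊗ P_L`, and `p_A(A) > 0` almost surely.
-/
theorem lawAL_absolutelyContinuous_prod (hdens : lawAL P ≪ volume.prod (lawL P)) :
    lawAL P ≪ (lawA P).prod (lawL P) := by
  have hA : Measurable fun z : ℝ × 𝓛 => (lawA P).rnDeriv volume z.1 :=
    (Measure.measurable_rnDeriv _ _).comp measurable_fst
  have h1 : ∀ᵐ z ∂(lawAL P), (lawA P).rnDeriv volume z.1 ≠ 0 := by
    have h2 := Measure.rnDeriv_pos (lawA_absolutelyContinuous hdens)
    rw [lawA, ae_map_iff measurable_obsA.aemeasurable (measurableSet_lt measurable_const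
      (Measure.measurable_rnDeriv _ _))] at h2
    have hs : MeasurableSet {z : ℝ × 𝓛 | (lawA P).rnDeriv volume z.1 ≠ 0} :=
      hA (measurableSet_singleton 0).compl
    rw [lawAL, ae_map_iff measurable_obsAL.aemeasurable hs]
    filter_upwards [h2] with o ho using ho.ne'
  refine Measure.AbsolutelyContinuous.mk fun s hs h0 => ?_
  rw [prod_law_eq_withDensity hdens] at h0
  have h3 : ∀ᵐ z ∂((volume.prod (lawL P)).withDensity fun z => (lawA P).rnDeriv volume z.1),
      z ∉ s := measure_eq_zero_iff_ae_notMem.1 h0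
  rw [ae_withDensity_iff hA] at h3
  refine measure_eq_zero_iff_ae_notMem.2 ?_
  filter_upwards [h1, hdens.ae_le h3] with z h4 h5 using h5 h4

/-! ### Regressions, relevance and the functional under `dQ = p dP` -/

section ChangeOfMeasure

variable {p : Obs 𝓛 𝓩 → ℝ} {K : ℝ} {π : 𝓩 × 𝓛 → ℝ} {q : ℝ → ℝ} {B ε : ℝ}

theorem integrable_mul_obsZpi (hπ : Measurable π) (hB : ∀ x, |π x| ≤ B) {f : Obs 𝓛 𝓩 → ℝ}
    (hf : Integrable f (P : Measure (Obs 𝓛 𝓩))) :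
    Integrable (fun o => f o * obsZpi π o) (P : Measure (Obs 𝓛 𝓩)) :=
  hf.mul_bdd (measurable_obsZpi hπ).aestronglyMeasurable (Eventually.of_forall fun _ => hB _)

theorem integrable_obsZpi (hπ : Measurable π) (hB : ∀ x, |π x| ≤ B) :
    Integrable (obsZpi π) (P : Measure (Obs 𝓛 𝓩)) :=
  Integrable.of_bound (measurable_obsZpi hπ).aestronglyMeasurable B
    (Eventually.of_forall fun _ => hB _)

theorem kappaFn_ae_eq (hp : IsRatio (P : Measure (Obs 𝓛 𝓩)) p K)
    (hQ : (Q : Measure (Obs 𝓛 𝓩)) = (P : Measure (Obs 𝓛 𝓩)).withDensity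
      fun x => ENNReal.ofReal (p x)) (hπ : Measurable π) (hB : ∀ x, |π x| ≤ B) :
    (fun o => kappaFn Q π (obsA o) (obsL o)) =ᵐ[(P : Measure (Obs 𝓛 𝓩))]
      condKappa (P : Measure (Obs 𝓛 𝓩)) (sigmaL 𝓛 𝓩) (sigmaAL 𝓛 𝓩) (obsZpi π) p := by
  have hZ := integrable_obsZpi (P := P) hπ hB
  filter_upwards [regression_comp_ae_eq_condRatio hp hQ measurable_obsAL hZ,
    regression_comp_ae_eq_condRatio hp hQ measurable_obsL hZ] with o h1 h2
  rw [condKappa, ← h1, ← h2]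
  rfl

theorem muFn_ae_eq (hp : IsRatio (P : Measure (Obs 𝓛 𝓩)) p K)
    (hQ : (Q : Measure (Obs 𝓛 𝓩)) = (P : Measure (Obs 𝓛 𝓩)).withDensity
      fun x => ENNReal.ofReal (p x)) (hπ : Measurable π) (hB : ∀ x, |π x| ≤ B)
    (hY : Integrable obsY (P : Measure (Obs 𝓛 𝓩))) :
    (fun o => muFn Q π (obsA o) (obsL o)) =ᵐ[(P : Measure (Obs 𝓛 𝓩))]
      condMu (P : Measure (Obs 𝓛 𝓩)) (sigmaL 𝓛 𝓩) (sigmaAL 𝓛 𝓩) obsY (obsZpi π) p := by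
  have hZ := integrable_obsZpi (P := P) hπ hB
  filter_upwards [regression_comp_ae_eq_condRatio hp hQ measurable_obsAL hY,
    regression_comp_ae_eq_condRatio hp hQ measurable_obsAL (integrable_mul_obsZpi hπ hB hY),
    regression_comp_ae_eq_condRatio hp hQ measurable_obsL hZ, kappaFn_ae_eq hp hQ hπ hB]
    with o h1 h2 h3 h4
  rw [condMu, ← h1, ← h2, ← h3, ← h4]
  rfl

/-- The outcome multiplied by the covariate shift weight `δ(A, L) q(A)`. -/
noncomputable def shiftedY (P : ProbabilityMeasure (Obs 𝓛 𝓩)) (q : ℝ → ℝ) (o : Obs 𝓛 𝓩) : ℝ :=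
  deltaFn P (obsA o) (obsL o) * q (obsA o) * obsY o

theorem measurable_shift (hq : Measurable q) : Measurable[sigmaAL 𝓛 𝓩]
    fun o : Obs 𝓛 𝓩 => deltaFn P (obsA o) (obsL o) * q (obsA o) :=
  measurable_sigmaAL_comp (f := fun x => deltaFn P x.1 x.2 * q x.1)
    (measurable_deltaFn.mul (hq.comp measurable_fst))

theorem isModel_obs (hq : Measurable q) (hπ : Measurable π) (hB : ∀ x, |π x| ≤ B)
    (hfin : MemLp (fun o => deltaFn P (obsA o) (obsL o) * q (obsA o) * obsY o) 2
      (P : Measure (Obs 𝓛 𝓩))) :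
    IsModel (P : Measure (Obs 𝓛 𝓩)) (sigmaA 𝓛 𝓩) (sigmaL 𝓛 𝓩) (sigmaAL 𝓛 𝓩) (shiftedY P q)
      (obsZpi π) B {o | q (obsA o) ≠ 0} where
  leA := sigmaA_le_sigmaAL
  leL := sigmaL_le_sigmaAL
  le := measurable_obsAL.comap_le
  memLp := hfin
  measurable := measurable_obsZpi hπ
  bound := fun _ => hB _
  measurableSet := measurable_sigmaAL_comp (f := fun x => q x.1) (hq.comp measurable_fst)
    (measurableSet_singleton 0).compl
  zero := fun o ho => by
    have : q (obsA o) = 0 := by simpa using ho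
    simp [shiftedY, this]

theorem condMu_shiftedY (hp : IsRatio (P : Measure (Obs 𝓛 𝓩)) p K)
    (hQ : (Q : Measure (Obs 𝓛 𝓩)) = (P : Measure (Obs 𝓛 𝓩)).withDensity
      fun x => ENNReal.ofReal (p x)) (hq : Measurable q) (hπ : Measurable π)
    (hB : ∀ x, |π x| ≤ B)
    (hY : Integrable obsY (P : Measure (Obs 𝓛 𝓩)))
    (hfin : MemLp (fun o => deltaFn P (obsA o) (obsL o) * q (obsA o) * obsY o) 2
      (P : Measure (Obs 𝓛 𝓩))) :
    condMu (P : Measure (Obs 𝓛 𝓩)) (sigmaL 𝓛 𝓩) (sigmaAL 𝓛 𝓩) (shiftedY P q) (obsZpi π) p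
      =ᵐ[(P : Measure (Obs 𝓛 𝓩))] fun o =>
        deltaFn P (obsA o) (obsL o) * (muFn Q π (obsA o) (obsL o) * q (obsA o)) := by
  have hw := hfin.integrable (q := 2) (by norm_num)
  have h1 := condMu_mul (mL := sigmaL 𝓛 𝓩) hp (measurable_shift (P := P) hq) hY hw
    (integrable_mul_obsZpi hπ hB hY)
    (by simpa only [mul_assoc] using integrable_mul_obsZpi hπ hB hw)
  filter_upwards [h1, muFn_ae_eq hp hQ hπ hB hY] with o h2 h3
  refine h2.trans ?_
  rw [← h3]
  ring

/-- The product of the marginal laws of `dQ = p dP`. -/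
theorem prod_law_eq_map_of_isRatio (hdens : lawAL P ≪ volume.prod (lawL P))
    (hpos : ∀ᵐ x ∂((lawA P).prod (lawL P)), 0 < densAgivenL P x.1 x.2)
    (hp : IsRatio (P : Measure (Obs 𝓛 𝓩)) p K)
    (hQ : (Q : Measure (Obs 𝓛 𝓩)) = (P : Measure (Obs 𝓛 𝓩)).withDensity
      fun x => ENNReal.ofReal (p x)) :
    (lawA Q).prod (lawL Q) = ((P : Measure (Obs 𝓛 𝓩)).withDensity
      fun o => ENNReal.ofReal (deltaFn P (obsA o) (obsL o) *
        (((P : Measure (Obs 𝓛 𝓩))[p | sigmaA 𝓛 𝓩]) o *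
          ((P : Measure (Obs 𝓛 𝓩))[p | sigmaL 𝓛 𝓩]) o))).map obsAL := by
  have hb := (measurable_regression P p obsA).ennreal_ofReal
  have hc := (measurable_regression P p obsL).ennreal_ofReal
  have hδ : Measurable fun o : Obs 𝓛 𝓩 => ENNReal.ofReal (deltaFn P (obsA o) (obsL o)) :=
    (measurable_deltaFn.comp measurable_obsAL).ennreal_ofReal
  have hbc : Measurable fun z : ℝ × 𝓛 =>
      ENNReal.ofReal (regression P p obsA z.1) * ENNReal.ofReal (regression P p obsL z.2) :=
    (hb.comp measurable_fst).mul (hc.comp measurable_snd)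
  have hbc' : Measurable fun o : Obs 𝓛 𝓩 => ENNReal.ofReal (regression P p obsA (obsAL o).1) *
      ENNReal.ofReal (regression P p obsL (obsAL o).2) := hbc.comp measurable_obsAL
  rw [lawA, lawL, hQ, map_withDensity_eq_regression P hp measurable_obsA,
    map_withDensity_eq_regression P hp measurable_obsL, prod_withDensity hb hc]
  change ((lawA P).prod (lawL P)).withDensity _ = _
  rw [prod_law_eq_map hdens hpos, ← map_withDensity_comp measurable_obsAL hbc,
    ← withDensity_mul _ hδ hbc']
  congr 1
  refine withDensity_congr_ae ?_
  filter_upwards [regression_comp_ae_eq P measurable_obsA hp.integrable,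
    regression_comp_ae_eq P measurable_obsL hp.integrable,
    hp.condExp_mem measurable_obsA.comap_le] with o h1 h2 h3
  rw [ENNReal.ofReal_mul (deltaFn_nonneg _ _),
    ENNReal.ofReal_mul ((inv_pos.2 hp.pos).le.trans h3.1), ← h1, ← h2]
  rfl

/-- The product of the `Q`-marginals and `P_{A,L}` have the same null sets, so the iterated
almost-everywhere statement becomes one about `(A, L)` under `P`. -/
theorem kappaBoundedBelow_iff (hdens : lawAL P ≪ volume.prod (lawL P))
    (hpos : ∀ᵐ x ∂((lawA P).prod (lawL P)), 0 < densAgivenL P x.1 x.2)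
    (hp : IsRatio (P : Measure (Obs 𝓛 𝓩)) p K)
    (hQ : (Q : Measure (Obs 𝓛 𝓩)) = (P : Measure (Obs 𝓛 𝓩)).withDensity
      fun x => ENNReal.ofReal (p x)) (hq : Measurable q) (hπ : Measurable π)
    (hB : ∀ x, |π x| ≤ B) :
    KappaBoundedBelow Q π (Function.support q) ε ↔
      ∀ᵐ o ∂(P : Measure (Obs 𝓛 𝓩)), o ∈ {o : Obs 𝓛 𝓩 | q (obsA o) ≠ 0} →
        ε ≤ |condKappa (P : Measure (Obs 𝓛 𝓩)) (sigmaL 𝓛 𝓩) (sigmaAL 𝓛 𝓩) (obsZpi π) p o| := by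
  have hac : (P : Measure (Obs 𝓛 𝓩)) ≪ (Q : Measure (Obs 𝓛 𝓩)) := by
    rw [hQ]
    refine withDensity_absolutelyContinuous' hp.measurable.ennreal_ofReal.aemeasurable ?_
    filter_upwards [hp.mem_Icc] with x hx
    exact (ENNReal.ofReal_pos.2 ((inv_pos.2 hp.pos).trans_le hx.1)).ne'
  have hac1 : lawAL P ≪ (lawA Q).prod (lawL Q) :=
    (lawAL_absolutelyContinuous_prod hdens).trans
      ((hac.map measurable_obsA).prod (hac.map measurable_obsL))
  have hac2 : (lawA Q).prod (lawL Q) ≪ lawAL P := by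
    rw [prod_law_eq_map_of_isRatio hdens hpos hp hQ]
    exact (withDensity_absolutelyContinuous _ _).map measurable_obsAL
  have hm : MeasurableSet {z : ℝ × 𝓛 | q z.1 ≠ 0 → ε ≤ |kappaFn Q π z.1 z.2|} := by
    have e : {z : ℝ × 𝓛 | q z.1 ≠ 0 → ε ≤ |kappaFn Q π z.1 z.2|} =
        {z | q z.1 ≠ 0}ᶜ ∪ {z | ε ≤ |kappaFn Q π z.1 z.2|} := by
      ext z
      simp [imp_iff_not_or]
    rw [e]
    refine MeasurableSet.union ?_ (measurableSet_le measurable_const (measurable_kappaFn π).abs)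
    exact ((hq.comp measurable_fst) (measurableSet_singleton 0).compl).compl
  have e1 : KappaBoundedBelow Q π (Function.support q) ε ↔
      ∀ᵐ z ∂((lawA Q).prod (lawL Q)), q z.1 ≠ 0 → ε ≤ |kappaFn Q π z.1 z.2| := by
    rw [Measure.ae_prod_iff_ae_ae hm, KappaBoundedBelow]
    refine eventually_congr (Eventually.of_forall fun a => ?_)
    by_cases ha : q a = 0 <;> simp [ha]
  rw [e1, ae_map_iff_of_ac measurable_obsAL hac1 hac2 hm]
  have hκ := kappaFn_ae_eq hp hQ hπ hB
  constructor <;> intro h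
  · filter_upwards [h, hκ] with o h1 h2
    rw [← h2]
    exact h1
  · filter_upwards [h, hκ] with o h1 h2
    rw [← h2] at h1
    exact h1

/-- By Fubini the functional is an integral against the product of the `Q`-marginals, of density `δ
b c`. The factor `δ q` goes into the outcome and `b c` stays as the weight; integrability holds
because an `L²` ratio is multiplied by a bounded weight. The weight `δ` is always that of `P`, so
one outcome serves the whole path. -/
theorem psiFn_eq_weightedPsi (hdens : lawAL P ≪ volume.prod (lawL P))
    (hpos : ∀ᵐ x ∂((lawA P).prod (lawL P)), 0 < densAgivenL P x.1 x.2)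
    (hp : IsRatio (P : Measure (Obs 𝓛 𝓩)) p K)
    (hQ : (Q : Measure (Obs 𝓛 𝓩)) = (P : Measure (Obs 𝓛 𝓩)).withDensity
      fun x => ENNReal.ofReal (p x)) (hq : Measurable q) (hπ : Measurable π)
    (hB : ∀ x, |π x| ≤ B)
    (hY : Integrable obsY (P : Measure (Obs 𝓛 𝓩)))
    (hfin : MemLp (fun o => deltaFn P (obsA o) (obsL o) * q (obsA o) * obsY o) 2
      (P : Measure (Obs 𝓛 𝓩))) (hε : 0 < ε)
    (hκ : KappaBoundedBelow Q π (Function.support q) ε) :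
    Integrable (fun x : ℝ × 𝓛 => muFn Q π x.1 x.2 * q x.1) ((lawA Q).prod (lawL Q)) ∧
      psiFn π q Q = weightedPsi (P : Measure (Obs 𝓛 𝓩)) (sigmaA 𝓛 𝓩) (sigmaL 𝓛 𝓩)
        (sigmaAL 𝓛 𝓩) (shiftedY P q) (obsZpi π) p := by
  have hM := isModel_obs hq hπ hB hfin
  have hA := hM.leA.trans hM.le
  have hL := hM.leL.trans hM.le
  have hκ' := (kappaBoundedBelow_iff hdens hpos hp hQ hq hπ hB).1 hκ
  have hK := inv_pos.2 hp.pos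
  have hbm : Measurable ((P : Measure (Obs 𝓛 𝓩))[p | sigmaA 𝓛 𝓩]) :=
    stronglyMeasurable_condExp.measurable.mono hA le_rfl
  have hcm : Measurable ((P : Measure (Obs 𝓛 𝓩))[p | sigmaL 𝓛 𝓩]) :=
    stronglyMeasurable_condExp.measurable.mono hL le_rfl
  have hD : Measurable fun o : Obs 𝓛 𝓩 => deltaFn P (obsA o) (obsL o) *
        (((P : Measure (Obs 𝓛 𝓩))[p | sigmaA 𝓛 𝓩]) o *
          ((P : Measure (Obs 𝓛 𝓩))[p | sigmaL 𝓛 𝓩]) o) :=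
    (measurable_deltaFn.comp measurable_obsAL).mul (hbm.mul hcm)
  have hD0 : ∀ᵐ o ∂(P : Measure (Obs 𝓛 𝓩)), 0 ≤ deltaFn P (obsA o) (obsL o) *
        (((P : Measure (Obs 𝓛 𝓩))[p | sigmaA 𝓛 𝓩]) o *
          ((P : Measure (Obs 𝓛 𝓩))[p | sigmaL 𝓛 𝓩]) o) := by
    filter_upwards [hp.condExp_mem hA, hp.condExp_mem hL] with o h1 h2
    exact mul_nonneg (deltaFn_nonneg _ _) (mul_nonneg (hK.le.trans h1.1) (hK.le.trans h2.1))
  have hF : Measurable fun x : ℝ × 𝓛 => muFn Q π x.1 x.2 * q x.1 :=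
    (measurable_muFn π).mul (hq.comp measurable_fst)
  have hae : (fun o : Obs 𝓛 𝓩 => deltaFn P (obsA o) (obsL o) *
        (((P : Measure (Obs 𝓛 𝓩))[p | sigmaA 𝓛 𝓩]) o *
          ((P : Measure (Obs 𝓛 𝓩))[p | sigmaL 𝓛 𝓩]) o) *
          (muFn Q π (obsA o) (obsL o) * q (obsA o))) =ᵐ[(P : Measure (Obs 𝓛 𝓩))]
      fun o => condMu (P : Measure (Obs 𝓛 𝓩)) (sigmaL 𝓛 𝓩) (sigmaAL 𝓛 𝓩) (shiftedY P q)
        (obsZpi π) p o * (((P : Measure (Obs 𝓛 𝓩))[p | sigmaA 𝓛 𝓩]) o *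
          ((P : Measure (Obs 𝓛 𝓩))[p | sigmaL 𝓛 𝓩]) o) := by
    filter_upwards [condMu_shiftedY hp hQ hq hπ hB hY hfin] with o h1
    rw [h1]
    ring
  have hint : Integrable (fun o => condMu (P : Measure (Obs 𝓛 𝓩)) (sigmaL 𝓛 𝓩) (sigmaAL 𝓛 𝓩)
      (shiftedY P q) (obsZpi π) p o * (((P : Measure (Obs 𝓛 𝓩))[p | sigmaA 𝓛 𝓩]) o *
          ((P : Measure (Obs 𝓛 𝓩))[p | sigmaL 𝓛 𝓩]) o)) (P : Measure (Obs 𝓛 𝓩)) := by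
    refine ((hM.condMu_memLp hp hε hκ').integrable (by norm_num)).mul_bdd (c := K * K)
      (hbm.mul hcm).aestronglyMeasurable ?_
    filter_upwards [hp.condExp_mem hA, hp.condExp_mem hL] with ω h1 h2
    rw [Real.norm_eq_abs, abs_mul, abs_of_nonneg (hK.le.trans h1.1),
      abs_of_nonneg (hK.le.trans h2.1)]
    exact mul_le_mul h1.2 h2.2 (hK.le.trans h2.1) hp.pos.le
  have hlaw := prod_law_eq_map_of_isRatio hdens hpos hp hQ
  have hI : Integrable (fun x : ℝ × 𝓛 => muFn Q π x.1 x.2 * q x.1)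
      ((lawA Q).prod (lawL Q)) := by
    rw [hlaw, integrable_map_measure hF.aestronglyMeasurable measurable_obsAL.aemeasurable]
    exact (integrable_withDensity_ofReal hD hD0).2 (hint.congr hae.symm)
  refine ⟨hI, ?_⟩
  have e1 : psiFn π q Q = ∫ x, muFn Q π x.1 x.2 * q x.1 ∂((lawA Q).prod (lawL Q)) :=
    (integral_prod _ hI).symm
  rw [e1, hlaw, integral_map measurable_obsAL.aemeasurable hF.aestronglyMeasurable,
    integral_withDensity_ofReal hD hD0]
  exact integral_congr_ae hae

end ChangeOfMeasure

end Bridge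

/-! ## The influence function and its derivative property -/

section Influence

variable {𝓛 𝓩 : Type*} [m𝓛 : MeasurableSpace 𝓛] [MeasurableSpace 𝓩]
  {P : ProbabilityMeasure (Obs 𝓛 𝓩)} {π : 𝓩 × 𝓛 → ℝ} {q : ℝ → ℝ} {B ε : ℝ}

theorem withDensity_one_real {α : Type*} {mα : MeasurableSpace α} (μ : Measure α) :
    μ = μ.withDensity fun _ => ENNReal.ofReal 1 := by
  simp

/-- At `p = 1` the gradient is `(Z - ρ)(R V - E[R V | L]) + E[μ | A] + E[μ | L]` for the shifted
outcome. The factor `δ` in `R V` and `μ` turns each conditional expectation given one variable into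
an integral over the marginal law of the other. -/
theorem eifFn_ae_eq (hdens : lawAL P ≪ volume.prod (lawL P))
    (hpos : ∀ᵐ x ∂((lawA P).prod (lawL P)), 0 < densAgivenL P x.1 x.2)
    (hq : Measurable q) (hπ : Measurable π) (hB : ∀ x, |π x| ≤ B)
    (hY : Integrable obsY (P : Measure (Obs 𝓛 𝓩)))
    (hfin : MemLp (fun o => deltaFn P (obsA o) (obsL o) * q (obsA o) * obsY o) 2
      (P : Measure (Obs 𝓛 𝓩))) (hε : 0 < ε)
    (hκ : KappaBoundedBelow P π (Function.support q) ε) :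
    eifFn P π q =ᵐ[(P : Measure (Obs 𝓛 𝓩))] fun o =>
      gradAt (P : Measure (Obs 𝓛 𝓩)) (sigmaA 𝓛 𝓩) (sigmaL 𝓛 𝓩) (sigmaAL 𝓛 𝓩) (shiftedY P q)
        (obsZpi π) {o | q (obsA o) ≠ 0} (fun _ => 1) o - 2 * psiFn π q P := by
  set M : Measure (Obs 𝓛 𝓩) := (P : Measure (Obs 𝓛 𝓩)) with hM
  have hM1 : M = M.withDensity fun _ => ENNReal.ofReal 1 := withDensity_one_real _
  have h1 : IsRatio M (fun _ => 1) 1 := isRatio_one le_rfl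
  have hmod := isModel_obs hq hπ hB hfin
  have hA := hmod.leA.trans hmod.le
  have hL := hmod.leL.trans hmod.le
  have hκ' := (kappaBoundedBelow_iff hdens hpos h1 hM1 hq hπ hB).1 hκ
  have hV := hmod.residual_memLp hε hκ'
  have hμ := hmod.condMu_memLp h1 hε hκ'
  have hRm : Measurable[sigmaAL 𝓛 𝓩] (invKappa M (sigmaL 𝓛 𝓩) (sigmaAL 𝓛 𝓩) (obsZpi π)
    {o | q (obsA o) ≠ 0} fun _ => 1) := hmod.measurable_invKappa
  have hRb := invKappa_bound hε hκ'
  have hRV := MemLp.bounded_mul hV (hRm.mono hmod.le le_rfl).aestronglyMeasurable hRb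
  have hR2 : MemLp (invKappa M (sigmaL 𝓛 𝓩) (sigmaAL 𝓛 𝓩) (obsZpi π)
    {o | q (obsA o) ≠ 0} fun _ => 1) 2 M :=
    MemLp.of_bound (hRm.mono hmod.le le_rfl).aestronglyMeasurable ε⁻¹ hRb
  have hmu := condMu_shiftedY h1 hM1 hq hπ hB hY hfin
  have hκe := kappaFn_ae_eq h1 hM1 hπ hB
  have hη := regression_comp_ae_eq P measurable_obsAL hY
  have hρ := regression_comp_ae_eq P measurable_obsL (integrable_obsZpi (P := P) hπ hB)
  have hδm : Measurable fun o : Obs 𝓛 𝓩 => deltaFn P (obsA o) (obsL o) :=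
    measurable_deltaFn.comp measurable_obsAL
  have hδ0 : ∀ᵐ o ∂M, 0 ≤ deltaFn P (obsA o) (obsL o) :=
    Eventually.of_forall fun _ => deltaFn_nonneg _ _
  have hprod := prod_law_eq_map hdens hpos
  have hprod' : (M.map obsL).prod (M.map obsA) = (M.withDensity
      fun o => ENNReal.ofReal (deltaFn P (obsA o) (obsL o))).map fun o => (obsL o, obsA o) := by
    have e := congrArg (Measure.map Prod.swap) hprod
    rw [Measure.prod_swap, Measure.map_map measurable_swap measurable_obsAL] at e
    exact e
  set R := invKappa M (sigmaL 𝓛 𝓩) (sigmaAL 𝓛 𝓩) (obsZpi π) {o | q (obsA o) ≠ 0} fun _ => 1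
    with hR
  set V := residual M (sigmaL 𝓛 𝓩) (sigmaAL 𝓛 𝓩) (shiftedY P q) (obsZpi π) with hVdef
  set μ := condMu M (sigmaL 𝓛 𝓩) (sigmaAL 𝓛 𝓩) (shiftedY P q) (obsZpi π) fun _ => 1 with hμdef
  -- Stated for arbitrary `x` and `y` because it is applied both to `V` and to `E[V | A, L]`; the
  -- case `q = 0` is settled once.
  have hRat : ∀ᵐ o ∂M, ∀ x y : ℝ, x = deltaFn P (obsA o) (obsL o) * (y * q (obsA o)) →
      R o * x = deltaFn P (obsA o) (obsL o) *
        (y / kappaFn P π (obsA o) (obsL o) * q (obsA o)) := by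
    filter_upwards [hκe] with o h2 x y hx
    by_cases ho : q (obsA o) = 0
    · simp [hx, ho]
    · have ho' : o ∈ {o : Obs 𝓛 𝓩 | q (obsA o) ≠ 0} := ho
      rw [hR, invKappa, Set.indicator_of_mem ho', ← h2, hx]
      ring
  have eRV : ∀ᵐ o ∂M, R o * V o = deltaFn P (obsA o) (obsL o) *
      ((obsY o - muFn P π (obsA o) (obsL o)) / kappaFn P π (obsA o) (obsL o) * q (obsA o)) := by
    filter_upwards [hRat, hmu] with o h2 h3
    refine h2 _ _ ?_
    rw [hVdef, residual, ← hμdef, h3, shiftedY]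
    ring
  have hYs : M[shiftedY P q | sigmaAL 𝓛 𝓩] =ᵐ[M] fun o =>
      deltaFn P (obsA o) (obsL o) * q (obsA o) * etaFn P (obsA o) (obsL o) := by
    have e := condExp_mul_of_stronglyMeasurable_left
      (measurable_shift (P := P) hq).stronglyMeasurable
      (hfin.integrable (q := 2) (by norm_num)) hY
    filter_upwards [e, hη] with o h2 h3
    refine h2.trans ?_
    rw [Pi.mul_apply, ← h3]
    rfl
  have eCond : M[fun o => R o * V o | sigmaAL 𝓛 𝓩] =ᵐ[M] fun o =>
      deltaFn P (obsA o) (obsL o) * ((etaFn P (obsA o) (obsL o) - muFn P π (obsA o) (obsL o)) /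
        kappaFn P π (obsA o) (obsL o) * q (obsA o)) := by
    have e1 := condExp_mul_of_memLp (m := sigmaAL 𝓛 𝓩)
      hRm.stronglyMeasurable.aestronglyMeasurable hR2 hV
    have e2 := hmod.condExp_residual hε hκ' h1
    simp only [mul_one, condExp_const hmod.le] at e2
    filter_upwards [e1, e2, hRat, hYs, hmu] with o h2 h3 h4 h5 h6
    rw [h2]
    refine h4 _ _ ?_
    refine h3.trans ?_
    have h5' : (M[fun o => shiftedY P q o | sigmaAL 𝓛 𝓩]) o = deltaFn P (obsA o) (obsL o) *
      q (obsA o) * etaFn P (obsA o) (obsL o) := h5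
    rw [h5', ← hμdef, h6]
    ring
  -- The tower property first replaces `Y` by `η(A, L)`, leaving `δ` times a function of `(A, L)`,
  -- to which the product density applies.
  have eL1 : M[fun o => R o * V o | sigmaL 𝓛 𝓩] =ᵐ[M] fun o =>
      ∫ a, (etaFn P a (obsL o) - muFn P π a (obsL o)) / kappaFn P π a (obsL o) * q a
        ∂(lawA P) := by
    have e1 : M[M[fun o => R o * V o | sigmaAL 𝓛 𝓩] | sigmaL 𝓛 𝓩] =ᵐ[M]
      M[fun o => R o * V o | sigmaL 𝓛 𝓩] := condExp_condExp_of_le hmod.leL hmod.le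
    have e2 := condExp_congr_ae (m := sigmaL 𝓛 𝓩) eCond
    have hf : Measurable fun z : 𝓛 × ℝ => (etaFn P z.2 z.1 - muFn P π z.2 z.1) /
        kappaFn P π z.2 z.1 * q z.2 :=
      (((measurable_etaFn.comp measurable_swap).sub
        ((measurable_muFn π).comp measurable_swap)).div
        ((measurable_kappaFn π).comp measurable_swap)).mul (hq.comp measurable_snd)
    have e3 := condExp_mul_prod_density measurable_obsL measurable_obsA hδm hδ0 hprod' hf
      ((integrable_condExp (m := sigmaAL 𝓛 𝓩)).congr eCond)
    exact (e3.trans (e2.symm.trans e1)).symm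
  have hμi : Integrable (fun o => deltaFn P (obsA o) (obsL o) *
      (muFn P π (obsA o) (obsL o) * q (obsA o))) M := (hμ.integrable (by norm_num)).congr hmu
  have eL2 : M[μ | sigmaL 𝓛 𝓩] =ᵐ[M] fun o => ∫ a, muFn P π a (obsL o) * q a ∂(lawA P) := by
    have hf : Measurable fun z : 𝓛 × ℝ => muFn P π z.2 z.1 * q z.2 :=
      ((measurable_muFn π).comp measurable_swap).mul (hq.comp measurable_snd)
    exact ((condExp_mul_prod_density measurable_obsL measurable_obsA hδm hδ0 hprod' hf hμi).trans
      (condExp_congr_ae hmu).symm).symm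
  have eA : M[μ | sigmaA 𝓛 𝓩] =ᵐ[M] fun o =>
      q (obsA o) * ∫ l, muFn P π (obsA o) l ∂(lawL P) := by
    have hf : Measurable fun z : ℝ × 𝓛 => muFn P π z.1 z.2 * q z.1 :=
      (measurable_muFn π).mul (hq.comp measurable_fst)
    have e3 := (condExp_mul_prod_density measurable_obsA measurable_obsL hδm hδ0 hprod hf
      hμi).trans (condExp_congr_ae (m := sigmaA 𝓛 𝓩) hmu).symm
    filter_upwards [e3] with o h2
    rw [← h2, integral_mul_const, mul_comm]
    rfl
  filter_upwards [eRV, eL1, eL2, eA, hρ] with o h2 h3 h4 h5 h6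
  simp only [gradAt, condExp_const hA, condExp_const hL, condExp_const hmod.le, mul_one, div_one,
    one_mul, eifFn]
  rw [h2, h3, h4, h5, ← h6]
  rfl

theorem hasScore_iff {Ω : Type*} [MeasurableSpace Ω] {P : ProbabilityMeasure Ω}
    {Q : ℝ → ProbabilityMeasure Ω} (h0 : Q 0 = P) (s : Ω → ℝ) :
    HasScore Q s ↔ MemLp s 2 (P : Measure Ω) ∧
      (∀ᶠ t in 𝓝 (0 : ℝ), (Q t : Measure Ω) ≪ (P : Measure Ω)) ∧
      Tendsto (fun t : ℝ =>
        (∫ o, (√(((Q t : Measure Ω).rnDeriv (P : Measure Ω) o).toReal) - 1 - t / 2 * s o) ^ 2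
        ∂(P : Measure Ω)) / t ^ 2) (𝓝[≠] 0) (𝓝 0) := by
  subst h0
  rfl

theorem KappaBoundedBelow.mono {N : Set ℝ} {ε ε' : ℝ} (h : KappaBoundedBelow P π N ε)
    (hε : ε' ≤ ε) : KappaBoundedBelow P π N ε' := by
  filter_upwards [h] with a ha haN
  filter_upwards [ha haN] with l hl using hε.trans hl

theorem hasDerivAt_psiFn (hdens : lawAL P ≪ volume.prod (lawL P))
    (hpos : ∀ᵐ x ∂((lawA P).prod (lawL P)), 0 < densAgivenL P x.1 x.2)
    (hq : Measurable q) (hπ : Measurable π) (hB : ∀ x, |π x| ≤ B)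
    (hY : Integrable obsY (P : Measure (Obs 𝓛 𝓩)))
    (hfin : MemLp (fun o => deltaFn P (obsA o) (obsL o) * q (obsA o) * obsY o) 2
      (P : Measure (Obs 𝓛 𝓩))) (hε : 0 < ε)
    (hκ : KappaBoundedBelow P π (Function.support q) ε)
    {Q : ℝ → ProbabilityMeasure (Obs 𝓛 𝓩)}
    (hQ : Q ∈ regularSubmodels π (Function.support q)) (hQ0 : Q 0 = P) {s : Obs 𝓛 𝓩 → ℝ}
    (hs : HasScore Q s) :
    HasDerivAt (fun t : ℝ => psiFn π q (Q t))
      (∫ o, eifFn P π q o * s o ∂(P : Measure (Obs 𝓛 𝓩))) 0 := by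
  obtain ⟨⟨K, hK⟩, ε', hε', hκQ⟩ := hQ
  rw [hasScore_iff hQ0] at hs
  obtain ⟨hs2, -, hdqm⟩ := hs
  have hM1 : (P : Measure (Obs 𝓛 𝓩)) = (P : Measure (Obs 𝓛 𝓩)).withDensity
      fun _ => ENNReal.ofReal 1 := withDensity_one_real _
  have hmod := isModel_obs hq hπ hB hfin
  -- The expansion uses one constant for both the baseline law and the path.
  have hε0 : 0 < min ε ε' := lt_min hε hε'
  have hκ0 := hκ.mono (min_le_left ε ε')
  have hκ' := (kappaBoundedBelow_iff hdens hpos (isRatio_one (le_refl 1)) hM1 hq hπ hB).1 hκ0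
  set S : Set ℝ := {t | ((Q t : Measure (Obs 𝓛 𝓩)) ≤ K • (Q 0 : Measure (Obs 𝓛 𝓩)) ∧
          (Q 0 : Measure (Obs 𝓛 𝓩)) ≤ K • (Q t : Measure (Obs 𝓛 𝓩))) ∧
          KappaBoundedBelow (Q t) π (Function.support q) ε'} with hSdef
  have hS : S ∈ 𝓝 (0 : ℝ) := hK.and hκQ
  set p : ℝ → Obs 𝓛 𝓩 → ℝ := fun t o =>
    ((Q t : Measure (Obs 𝓛 𝓩)).rnDeriv (P : Measure (Obs 𝓛 𝓩)) o).toReal with hpdef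
  have hpS : ∀ t ∈ S, IsRatio (P : Measure (Obs 𝓛 𝓩)) (p t) K ∧
      (Q t : Measure (Obs 𝓛 𝓩)) = (P : Measure (Obs 𝓛 𝓩)).withDensity
        fun x => ENNReal.ofReal (p t x) := by
    intro t ht
    have h1 := ht.1
    rw [hQ0] at h1
    exact exists_isRatio h1.1 h1.2
  have hκS : ∀ t ∈ S, KappaBoundedBelow (Q t) π (Function.support q) (min ε ε') :=
    fun t ht => ht.2.mono (min_le_right ε ε')
  have hp1 : ∀ t ∈ S, ∫ o, p t o ∂(P : Measure (Obs 𝓛 𝓩)) = 1 := by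
    intro t ht
    obtain ⟨h1, h2⟩ := hpS t ht
    have h3 := integral_withDensity_ofReal h1.measurable (by
      filter_upwards [h1.mem_Icc] with x hx using (inv_pos.2 h1.pos).le.trans hx.1)
      (fun _ : Obs 𝓛 𝓩 => (1 : ℝ))
    rw [← h2] at h3
    simpa using h3.symm
  -- This removes the constant `2ψ` by which the gradient and the influence function differ.
  have hmean : ∫ o, s o ∂(P : Measure (Obs 𝓛 𝓩)) = 0 :=
    hmod.integral_score_eq_zero hS (fun t ht => (hpS t ht).1) hp1 hs2 hdqm
  have hslope := hmod.tendsto_weightedPsi_slope hε0 hκ' hS (fun t ht => (hpS t ht).1)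
    (fun t ht => (kappaBoundedBelow_iff hdens hpos (hpS t ht).1 (hpS t ht).2 hq hπ hB).1
      (hκS t ht)) hs2 hdqm
  have hgrad := (hmod.integral_gradAt_one hε0 hκ').1
  have hlim : ∫ o, eifFn P π q o * s o ∂(P : Measure (Obs 𝓛 𝓩)) =
      ∫ o, gradAt (P : Measure (Obs 𝓛 𝓩)) (sigmaA 𝓛 𝓩) (sigmaL 𝓛 𝓩) (sigmaAL 𝓛 𝓩)
        (shiftedY P q) (obsZpi π) {o | q (obsA o) ≠ 0} (fun _ => 1) o * s o
        ∂(P : Measure (Obs 𝓛 𝓩)) := by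
    have i1 := hgrad.integrable_mul hs2
    have i2 : Integrable (fun o => 2 * psiFn π q P * s o) (P : Measure (Obs 𝓛 𝓩)) :=
      (hs2.integrable (by norm_num)).const_mul _
    have e : ∫ o, eifFn P π q o * s o ∂(P : Measure (Obs 𝓛 𝓩)) = _ :=
      (integral_congr_ae (g := fun o => _ - 2 * psiFn π q P * s o) (by
        filter_upwards [eifFn_ae_eq hdens hpos hq hπ hB hY hfin hε hκ] with o h1
        rw [h1, sub_mul]
        rfl)).trans (integral_sub i1 i2)
    rw [e, integral_const_mul, hmean, mul_zero, sub_zero]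
    rfl
  rw [hasDerivAt_iff_tendsto_slope, hlim]
  have hψ0 := (congrArg (psiFn π q) hQ0).trans (psiFn_eq_weightedPsi hdens hpos
    (isRatio_one (le_refl 1)) hM1 hq hπ hB hY hfin hε0 hκ0).2
  refine hslope.congr' ?_
  filter_upwards [nhdsWithin_le_nhds hS] with t ht
  rw [slope_def_field, sub_zero, hψ0, (psiFn_eq_weightedPsi hdens hpos (hpS t ht).1 (hpS t ht).2
    hq hπ hB hY hfin hε0 (hκS t ht)).2]

end Influence

/-! ## The tangent space -/

section Tangent

/-! ### Linear paths and approximation by bounded scores -/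

section LinearPath

variable {Ω : Type*} {m0 : MeasurableSpace Ω}

open Classical in
/-- The linear path `(1 + t g) P`, where this is a probability law. -/
noncomputable def linearPath (P : ProbabilityMeasure Ω) (g : Ω → ℝ) (t : ℝ) :
    ProbabilityMeasure Ω :=
  if h : IsProbabilityMeasure
      ((P : Measure Ω).withDensity fun ω => ENNReal.ofReal (1 + t * g ω)) then ⟨_, h⟩ else P

variable {P : ProbabilityMeasure Ω} {g : Ω → ℝ} {G t : ℝ}

theorem isRatio_linear (hg : Measurable g) (hG : ∀ ω, |g ω| ≤ G) (ht : |t| * G ≤ 1 / 2) :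
    IsRatio (P : Measure Ω) (fun ω => 1 + t * g ω) 2 := by
  refine ⟨(hg.const_mul t).const_add 1, one_le_two, Eventually.of_forall fun ω => ?_⟩
  have h1 : |t * g ω| ≤ 1 / 2 := by
    rw [abs_mul]
    exact (mul_le_mul_of_nonneg_left (hG ω) (abs_nonneg t)).trans ht
  rw [abs_le] at h1
  constructor <;> norm_num <;> linarith

theorem coe_linearPath (hg : Measurable g) (hG : ∀ ω, |g ω| ≤ G)
    (hg0 : ∫ ω, g ω ∂(P : Measure Ω) = 0) (ht : |t| * G ≤ 1 / 2) :
    (linearPath P g t : Measure Ω) =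
      (P : Measure Ω).withDensity fun ω => ENNReal.ofReal (1 + t * g ω) := by
  have hr := isRatio_linear (P := P) hg hG ht
  have hgi : Integrable g (P : Measure Ω) :=
    Integrable.of_bound hg.aestronglyMeasurable G (Eventually.of_forall hG)
  have h : IsProbabilityMeasure
      ((P : Measure Ω).withDensity fun ω => ENNReal.ofReal (1 + t * g ω)) := by
    refine ⟨?_⟩
    rw [withDensity_apply _ MeasurableSet.univ, Measure.restrict_univ,
      ← ofReal_integral_eq_lintegral_ofReal hr.integrable (by
        filter_upwards [hr.mem_Icc] with x hx using (inv_pos.2 hr.pos).le.trans hx.1),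
      integral_add (integrable_const 1) (hgi.const_mul t), integral_const_mul, hg0]
    simp
  have e : linearPath P g t = (⟨_, h⟩ : ProbabilityMeasure Ω) := dif_pos h
  exact congrArg ProbabilityMeasure.toMeasure e

theorem linearPath_zero : linearPath P g 0 = P := by
  have e : ((P : Measure Ω).withDensity fun ω => ENNReal.ofReal (1 + 0 * g ω)) =
      (P : Measure Ω) := by
    simp
  have h : IsProbabilityMeasure
      ((P : Measure Ω).withDensity fun ω => ENNReal.ofReal (1 + 0 * g ω)) :=
    e.symm ▸ inferInstance
  have e' : linearPath P g 0 = (⟨_, h⟩ : ProbabilityMeasure Ω) := dif_pos h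
  exact e'.trans (Subtype.ext e)

theorem eventually_abs_mul_le (G : ℝ) {c : ℝ} (hc : 0 < c) : ∀ᶠ t in 𝓝 (0 : ℝ), |t| * G ≤ c := by
  have h : Tendsto (fun t : ℝ => |t| * G) (𝓝 0) (𝓝 (|0| * G)) :=
    (continuous_abs.mul continuous_const).tendsto 0
  simp only [abs_zero, zero_mul] at h
  exact (h.eventually (gt_mem_nhds hc)).mono fun _ => le_of_lt

/-- With `y = √(1 + x)`, the left side is `(y - 1)² / 2`, while `x² = (y - 1)² (y + 1)²` and `y + 1
≥ 1`. -/
theorem abs_sqrt_one_add_sub_le {x : ℝ} (hx : 0 ≤ 1 + x) : |√(1 + x) - 1 - x / 2| ≤ x ^ 2 / 2 := by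
  have h1 := Real.sq_sqrt hx
  have h2 := Real.sqrt_nonneg (1 + x)
  set y := √(1 + x)
  have h3 : x = y ^ 2 - 1 := by linarith
  rw [h3, abs_le]
  constructor
  · nlinarith [sq_nonneg (y - 1), mul_nonneg h2 (sq_nonneg (y - 1)),
      mul_nonneg (sq_nonneg y) (sq_nonneg (y - 1))]
  · nlinarith [sq_nonneg (y - 1), sq_nonneg (y ^ 2 - 1)]

/-- The remainder is at most `t² G² / 2` pointwise, so its squared norm divided by `t²` is `O(t²)`.
The score is allowed to be any version of `g`, since the tangent space consists of classes. -/
theorem hasScore_linearPath (hg : Measurable g) (hG : ∀ ω, |g ω| ≤ G)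
    (hg0 : ∫ ω, g ω ∂(P : Measure Ω) = 0) {s : Ω → ℝ} (hs : s =ᵐ[(P : Measure Ω)] g) :
    HasScore (linearPath P g) s := by
  have hg2 : MemLp g 2 (P : Measure Ω) :=
    MemLp.of_bound hg.aestronglyMeasurable G (Eventually.of_forall hG)
  have hev := eventually_abs_mul_le G (c := 1 / 2) (by norm_num)
  rw [hasScore_iff linearPath_zero]
  refine ⟨hg2.ae_eq hs.symm, ?_, ?_⟩
  · filter_upwards [hev] with t ht
    rw [coe_linearPath hg hG hg0 ht]
    exact withDensity_absolutelyContinuous _ _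
  have hlim : Tendsto (fun t : ℝ => t ^ 2 * (G ^ 2 / 2) ^ 2) (𝓝[≠] 0) (𝓝 0) := by
    have : Tendsto (fun t : ℝ => t ^ 2 * (G ^ 2 / 2) ^ 2) (𝓝 0)
        (𝓝 ((0 : ℝ) ^ 2 * (G ^ 2 / 2) ^ 2)) :=
      ((continuous_pow 2).mul continuous_const).tendsto 0
    simp only [ne_eq, OfNat.ofNat_ne_zero, not_false_eq_true, zero_pow, zero_mul] at this
    exact this.mono_left nhdsWithin_le_nhds
  refine tendsto_of_tendsto_of_tendsto_of_le_of_le' tendsto_const_nhds hlim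
    (Eventually.of_forall fun t => div_nonneg (integral_nonneg fun _ => sq_nonneg _)
      (sq_nonneg t)) ?_
  filter_upwards [nhdsWithin_le_nhds hev, self_mem_nhdsWithin] with t ht ht0
  have ht0' : (t : ℝ) ≠ 0 := ht0
  have hr := isRatio_linear (P := P) hg hG ht
  rw [coe_linearPath hg hG hg0 ht, div_le_iff₀ (by positivity)]
  have hb : ∀ᵐ ω ∂(P : Measure Ω), ‖(√((((P : Measure Ω).withDensity
      fun ω => ENNReal.ofReal (1 + t * g ω)).rnDeriv (P : Measure Ω) ω).toReal) - 1 -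
        t / 2 * s ω) ^ 2‖ ≤ (t ^ 2 * (G ^ 2 / 2)) ^ 2 := by
    filter_upwards [Measure.rnDeriv_withDensity (P : Measure Ω) hr.measurable.ennreal_ofReal,
      hs, hr.mem_Icc] with ω h1 h2 h3
    have h4 : 0 ≤ 1 + t * g ω := (by norm_num : (0 : ℝ) ≤ 2⁻¹).trans h3.1
    rw [h1, h2, ENNReal.toReal_ofReal h4, norm_pow, Real.norm_eq_abs]
    refine pow_le_pow_left₀ (abs_nonneg _) ?_ 2
    have h5 := abs_sqrt_one_add_sub_le h4
    have h6 : (g ω) ^ 2 ≤ G ^ 2 := by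
      rw [← sq_abs]
      exact pow_le_pow_left₀ (abs_nonneg _) (hG ω) 2
    calc |√(1 + t * g ω) - 1 - t / 2 * g ω| = |√(1 + t * g ω) - 1 - t * g ω / 2| := by
          congr 1; ring
      _ ≤ (t * g ω) ^ 2 / 2 := h5
      _ = t ^ 2 * ((g ω) ^ 2 / 2) := by ring
      _ ≤ t ^ 2 * (G ^ 2 / 2) := by gcongr
  have := norm_integral_le_of_norm_le_const hb
  rw [probReal_univ, mul_one] at this
  refine (le_abs_self _).trans (this.trans (le_of_eq ?_))
  ring

theorem withDensity_le_and_le {α : Type*} {mα : MeasurableSpace α} {μ : Measure α} {p : α → ℝ}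
    (hp : IsRatio μ p 2) :
    (μ.withDensity fun x => ENNReal.ofReal (p x)) ≤ (2 : ℝ≥0) • μ ∧
      μ ≤ (2 : ℝ≥0) • μ.withDensity fun x => ENNReal.ofReal (p x) := by
  have hm := hp.measurable.ennreal_ofReal
  constructor
  · have : (2 : ℝ≥0) • μ = μ.withDensity fun _ => 2 := by
      rw [withDensity_const]
      rfl
    rw [this]
    refine withDensity_mono ?_
    filter_upwards [hp.mem_Icc] with x hx
    simpa using ENNReal.ofReal_le_ofReal hx.2
  · have : (2 : ℝ≥0) • μ.withDensity (fun x => ENNReal.ofReal (p x)) =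
        μ.withDensity ((2 : ℝ≥0∞) • fun x => ENNReal.ofReal (p x)) := by
      rw [withDensity_smul _ hm]
      rfl
    rw [this]
    conv_lhs => rw [← withDensity_one (μ := μ)]
    refine withDensity_mono ?_
    filter_upwards [hp.mem_Icc] with x hx
    have h2 : (2 : ℝ≥0∞) = ENNReal.ofReal 2 := by simp
    rw [Pi.smul_apply, smul_eq_mul, h2, ← ENNReal.ofReal_mul (by norm_num), Pi.one_apply,
      ← ENNReal.ofReal_one]
    refine ENNReal.ofReal_le_ofReal ?_
    linarith [hx.1]

/-- With `y = E[Z p | m]`, `z = E[Z | m]` and `e = E[p | m]`, one has `y / e - z = (y - z - z (e -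
1)) / e`. The numerator is at most `2 B τ`, and `e ≥ 1/2` doubles it. -/
theorem abs_condRatio_sub_le {μ : Measure Ω} [IsProbabilityMeasure μ] {m : MeasurableSpace Ω}
    (hm : m ≤ m0) {p Z : Ω → ℝ} {B τ : ℝ} (hp : IsRatio μ p 2) (hZ : Measurable[m0] Z)
    (hB : ∀ ω, |Z ω| ≤ B) (hτ : ∀ᵐ ω ∂μ, |p ω - 1| ≤ τ) :
    ∀ᵐ ω ∂μ, |condRatio μ m p Z ω - condRatio μ m (fun _ => 1) Z ω| ≤ 4 * B * τ := by
  have hZi : Integrable Z μ :=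
    Integrable.of_bound hZ.aestronglyMeasurable B (Eventually.of_forall hB)
  have hZb := condExp_mem_Icc hm hZi (Eventually.of_forall fun ω => abs_le.1 (hB ω))
  have hs : Integrable (fun ω => p ω - 1) μ := hp.integrable.sub (integrable_const 1)
  have hZs : Integrable (fun ω => Z ω * (p ω - 1)) μ :=
    hs.bdd_mul hZ.aestronglyMeasurable (Eventually.of_forall hB)
  have h1 : ∀ᵐ ω ∂μ, (μ[fun ω => p ω - 1 | m]) ω ∈ Set.Icc (-τ) τ :=
    condExp_mem_Icc hm hs (by filter_upwards [hτ] with ω hω using abs_le.1 hω)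
  have h2 : ∀ᵐ ω ∂μ, (μ[fun ω => Z ω * (p ω - 1) | m]) ω ∈ Set.Icc (-(B * τ)) (B * τ) := by
    refine condExp_mem_Icc hm hZs ?_
    filter_upwards [hτ] with ω hω
    refine abs_le.1 ?_
    rw [abs_mul]
    exact mul_le_mul (hB ω) hω (abs_nonneg _) ((abs_nonneg _).trans (hB ω))
  have e1 := condExp_sub (m := m) hp.integrable (integrable_const (μ := μ) (1 : ℝ))
  have e2 := condExp_sub (m := m) (hp.mul_integrable hZi) hZi
  have e3 : (fun ω => Z ω * (p ω - 1)) = (fun ω => Z ω * p ω) - Z := by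
    ext ω; simp [mul_sub]
  rw [condExp_const hm] at e1
  rw [e3] at h2
  filter_upwards [h1, h2, e1, e2, hZb, hp.condExp_mem hm] with ω h3 h4 h5 h6 h7 h8
  have h5' : (μ[fun ω => p ω - 1 | m]) ω = (μ[p | m]) ω - 1 := h5
  rw [h5'] at h3
  rw [h6, Pi.sub_apply] at h4
  rw [condRatio_one hm, condRatio]
  have he : 0 < (μ[p | m]) ω := (by norm_num : (0 : ℝ) < 2⁻¹).trans_le h8.1
  have h9 := abs_le.2 h3
  have h10 := abs_le.2 h4
  have h11 := abs_le.2 h7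
  set e := (μ[p | m]) ω
  set z := (μ[Z | m]) ω
  set y := (μ[fun ω => Z ω * p ω | m]) ω
  have hk : y / e - z = (y - z - z * (e - 1)) / e := by
    field_simp
    ring
  rw [hk, abs_div, abs_of_pos he, div_le_iff₀ he]
  have h12 : |y - z - z * (e - 1)| ≤ B * τ + B * τ := by
    refine (abs_sub _ _).trans (add_le_add h10 ?_)
    rw [abs_mul]
    exact mul_le_mul h11 h9 (abs_nonneg _) ((abs_nonneg _).trans h11)
  have h13 : 0 ≤ B * τ := (abs_nonneg _).trans h10
  have h14 : (2 : ℝ)⁻¹ ≤ e := h8.1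
  nlinarith

theorem exists_bounded_tendstoMeanSquare {Q : Measure Ω} [IsProbabilityMeasure Q] {g : Ω → ℝ}
    (hgm : Measurable g) (hg : MemLp g 2 Q) (hg0 : ∫ ω, g ω ∂Q = 0) :
    ∃ f : ℕ → Ω → ℝ, (∀ n, Measurable (f n) ∧ (∃ G, ∀ ω, |f n ω| ≤ G) ∧ ∫ ω, f n ω ∂Q = 0) ∧
      TendstoMeanSquare Q f atTop g := by
  set u : ℕ → Ω → ℝ := fun n => {ω | |g ω| ≤ n}.indicator fun _ => 1 with hu
  have hset : ∀ n : ℕ, MeasurableSet {ω | |g ω| ≤ n} := fun n =>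
    measurableSet_le hgm.abs measurable_const
  have hum : ∀ n, Measurable (u n) := fun n => measurable_const.indicator (hset n)
  have hb : ∀ n ω, |u n ω| ≤ 1 := by
    intro n ω
    simp only [hu, Set.indicator]
    split_ifs <;> simp
  have hlim : ∀ ω, Tendsto (fun n => u n ω) atTop (𝓝 1) := by
    intro ω
    refine tendsto_const_nhds.congr' ?_
    obtain ⟨n0, hn0⟩ := exists_nat_ge |g ω|
    filter_upwards [eventually_ge_atTop n0] with n hn
    have : |g ω| ≤ n := hn0.trans (by exact_mod_cast hn)
    simp [hu, this]
  have h1 := TendstoMeanSquare.mul_of_ae_tendsto (v := fun _ => 1) (C := 1) hg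
    (fun n => (hum n).aestronglyMeasurable) (fun n => Eventually.of_forall (hb n))
    (Eventually.of_forall hlim)
  have hub : ∀ n ω, |u n ω * g ω| ≤ n := by
    intro n ω
    by_cases h : |g ω| ≤ n
    · simp [hu, h]
    · simp [hu, h]
  -- Conditioning on the trivial σ-algebra is taking the mean: the truncations are recentred, and
  -- the correction tends to the mean of `g`, which is zero.
  have h2 := h1.add (h1.condExp ⊥).neg
  simp only [condExp_bot, one_mul, hg0] at h2
  refine ⟨fun n ω => u n ω * g ω - ∫ ω, u n ω * g ω ∂Q, fun n => ⟨?_, ?_, ?_⟩, ?_⟩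
  · exact ((hum n).mul hgm).sub_const _
  · exact ⟨n + |∫ ω, u n ω * g ω ∂Q|, fun ω => (abs_sub _ _).trans
      (add_le_add (hub n ω) le_rfl)⟩
  · rw [integral_sub ((h1.memLp n).integrable (by norm_num)) (integrable_const _)]
    simp
  · refine h2.congr (fun n => Eventually.of_forall fun ω => ?_)
      (Eventually.of_forall fun ω => ?_)
    · simp [sub_eq_add_neg]
    · simp

end LinearPath

variable {𝓛 𝓩 : Type*} [m𝓛 : MeasurableSpace 𝓛] [MeasurableSpace 𝓩]
  {P : ProbabilityMeasure (Obs 𝓛 𝓩)} {π : 𝓩 × 𝓛 → ℝ} {q : ℝ → ℝ} {B ε : ℝ}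

theorem linearPath_mem_regularSubmodels (hdens : lawAL P ≪ volume.prod (lawL P))
    (hpos : ∀ᵐ x ∂((lawA P).prod (lawL P)), 0 < densAgivenL P x.1 x.2)
    (hq : Measurable q) (hπ : Measurable π) (hB : ∀ x, |π x| ≤ B) (hε : 0 < ε)
    (hκ : KappaBoundedBelow P π (Function.support q) ε)
    {g : Obs 𝓛 𝓩 → ℝ} {G : ℝ} (hg : Measurable g) (hG : ∀ ω, |g ω| ≤ G)
    (hg0 : ∫ ω, g ω ∂(P : Measure (Obs 𝓛 𝓩)) = 0) :
    linearPath P g ∈ regularSubmodels π (Function.support q) := by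
  have hM1 : (P : Measure (Obs 𝓛 𝓩)) = (P : Measure (Obs 𝓛 𝓩)).withDensity
      fun _ => ENNReal.ofReal 1 := withDensity_one_real _
  have hκ' := (kappaBoundedBelow_iff hdens hpos (isRatio_one (le_refl 1)) hM1 hq hπ hB).1 hκ
  have hev := eventually_abs_mul_le G (c := 1 / 2) (by norm_num)
  refine ⟨⟨2, ?_⟩, ε / 2, half_pos hε, ?_⟩
  · filter_upwards [hev] with t ht
    rw [linearPath_zero, coe_linearPath hg hG hg0 ht]
    exact withDensity_le_and_le (isRatio_linear hg hG ht)
  -- Each of the two regressions in `κ` moves by at most `4 B |t| G`, so `κ` moves by at most `8 B G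
  -- |t| ≤ ε / 2`.
  · have hev2 := eventually_abs_mul_le (8 * B * G) (half_pos hε)
    filter_upwards [hev, hev2] with t ht ht2
    have hr := isRatio_linear (P := P) hg hG ht
    have hτ : ∀ᵐ ω ∂(P : Measure (Obs 𝓛 𝓩)), |1 + t * g ω - 1| ≤ |t| * G :=
      Eventually.of_forall fun ω => by
        rw [add_sub_cancel_left, abs_mul]
        exact mul_le_mul_of_nonneg_left (hG ω) (abs_nonneg t)
    refine (kappaBoundedBelow_iff hdens hpos hr (coe_linearPath hg hG hg0 ht) hq hπ hB).2 ?_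
    filter_upwards [hκ', abs_condRatio_sub_le (measurable_obsAL.comap_le) hr
      (measurable_obsZpi hπ) (fun _ => hB _) hτ, abs_condRatio_sub_le (measurable_obsL.comap_le) hr
      (measurable_obsZpi hπ) (fun _ => hB _) hτ] with o h1 h2 h3 ho
    have h4 := h1 ho
    simp only [condKappa] at h4 ⊢
    set a := condRatio (P : Measure (Obs 𝓛 𝓩)) (sigmaAL 𝓛 𝓩) (fun ω => 1 + t * g ω) (obsZpi π) o
    set b := condRatio (P : Measure (Obs 𝓛 𝓩)) (sigmaL 𝓛 𝓩) (fun ω => 1 + t * g ω) (obsZpi π) o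
    set a' := condRatio (P : Measure (Obs 𝓛 𝓩)) (sigmaAL 𝓛 𝓩) (fun _ => 1) (obsZpi π) o
    set b' := condRatio (P : Measure (Obs 𝓛 𝓩)) (sigmaL 𝓛 𝓩) (fun _ => 1) (obsZpi π) o
    have h5 : |a' - b'| ≤ |a - b| + |a - a'| + |b - b'| := by
      have e : a' - b' = ((a - b) - (a - a')) + (b - b') := by ring
      rw [e]
      exact (abs_add_le _ _).trans (add_le_add (abs_sub _ _) le_rfl)
    have h2' : |a - a'| ≤ 4 * B * (|t| * G) := h2
    have h3' : |b - b'| ≤ 4 * B * (|t| * G) := h3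
    have e8 : |t| * (8 * B * G) = 4 * B * (|t| * G) + 4 * B * (|t| * G) := by ring
    linarith

theorem mem_tangentSpace (hdens : lawAL P ≪ volume.prod (lawL P))
    (hpos : ∀ᵐ x ∂((lawA P).prod (lawL P)), 0 < densAgivenL P x.1 x.2)
    (hq : Measurable q) (hπ : Measurable π) (hB : ∀ x, |π x| ≤ B) (hε : 0 < ε)
    (hκ : KappaBoundedBelow P π (Function.support q) ε)
    (g : Lp ℝ 2 (P : Measure (Obs 𝓛 𝓩))) (hg0 : ∫ o, g o ∂(P : Measure (Obs 𝓛 𝓩)) = 0) :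
    g ∈ tangentSpace (regularSubmodels π (Function.support q)) P := by
  obtain ⟨f, hf, hlim⟩ := exists_bounded_tendstoMeanSquare (Lp.stronglyMeasurable g).measurable
    (Lp.memLp g) hg0
  have t1 := (Lp.tendsto_Lp_iff_tendsto_eLpNorm'' f hlim.memLp (g : Obs 𝓛 𝓩 → ℝ)
    hlim.memLp_limit).2 hlim.tendsto
  rw [Lp.toLp_coeFn] at t1
  refine mem_closure_of_tendsto t1 (Eventually.of_forall fun n => Submodule.subset_span ?_)
  obtain ⟨hm, ⟨G, hG⟩, h0⟩ := hf n
  exact ⟨linearPath P (f n), linearPath_mem_regularSubmodels hdens hpos hq hπ hB hε hκ hm hG h0,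
    linearPath_zero, hasScore_linearPath hm hG h0 (hlim.memLp n).coeFn_toLp⟩

end Tangent

end CovariateShift

/-! ### The efficient influence function -/

theorem theorem2 {𝓛 𝓩 : Type*} [MeasurableSpace 𝓛] [MeasurableSpace 𝓩]
    (P : MeasureTheory.ProbabilityMeasure (CovariateShift.Obs 𝓛 𝓩))
    (π : 𝓩 × 𝓛 → ℝ) (q : ℝ → ℝ) (hq : Measurable q)
    -- the treatment has a conditional density given the covariates, which is positive
    -- on the support of the marginal law of the treatment
    (hdens : CovariateShift.lawAL P ≪ volume.prod (CovariateShift.lawL P))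
    (hpos : ∀ᵐ x ∂((CovariateShift.lawA P).prod (CovariateShift.lawL P)),
      0 < CovariateShift.densAgivenL P x.1 x.2)
    -- `π` is a uniform regular weighting function for the support of `q`
    (hπ : CovariateShift.IsURWF P π (Function.support q))
    -- the moments that make the regression of `Y` and the variance of the score finite
    (hY : Integrable CovariateShift.obsY (P : Measure (CovariateShift.Obs 𝓛 𝓩)))
    (hfin : MemLp (fun o => CovariateShift.deltaFn P (CovariateShift.obsA o) (CovariateShift.obsL o)
        * q (CovariateShift.obsA o) * CovariateShift.obsY o) 2
      (P : Measure (CovariateShift.Obs 𝓛 𝓩))) :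
    Integrable (fun x : ℝ × 𝓛 => CovariateShift.muFn P π x.1 x.2 * q x.1)
        ((CovariateShift.lawA P).prod (CovariateShift.lawL P)) ∧
      CovariateShift.IsEIF (CovariateShift.regularSubmodels π (Function.support q))
        (CovariateShift.psiFn π q) P (CovariateShift.eifFn P π q) ∧
      -- the submodels leave the tangent space unrestricted, so the model is nonparametric
      ∀ g : Lp ℝ 2 (P : Measure (CovariateShift.Obs 𝓛 𝓩)),
        ∫ o, g o ∂(P : Measure (CovariateShift.Obs 𝓛 𝓩)) = 0 →
          g ∈ CovariateShift.tangentSpace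
            (CovariateShift.regularSubmodels π (Function.support q)) P := by
  open CovariateShift in
  obtain ⟨-, hπm, ⟨B, hB⟩, ε, hε, hκ⟩ := hπ
  have hM1 : (P : Measure (Obs 𝓛 𝓩)) = (P : Measure (Obs 𝓛 𝓩)).withDensity
      fun _ => ENNReal.ofReal 1 := withDensity_one_real _
  have h1 : IsRatio (P : Measure (Obs 𝓛 𝓩)) (fun _ => 1) 1 := isRatio_one le_rfl
  have hmod := isModel_obs hq hπm hB hfin
  have hκ' := (kappaBoundedBelow_iff hdens hpos h1 hM1 hq hπm hB).1 hκ
  obtain ⟨hint, hψ⟩ := psiFn_eq_weightedPsi hdens hpos h1 hM1 hq hπm hB hY hfin hε hκ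
  obtain ⟨hgrad, hgint⟩ := hmod.integral_gradAt_one hε hκ'
  have heif := eifFn_ae_eq hdens hpos hq hπm hB hY hfin hε hκ
  have hmem : MemLp (eifFn P π q) 2 (P : Measure (Obs 𝓛 𝓩)) :=
    (hgrad.sub (memLp_const (2 * psiFn π q P))).ae_eq heif.symm
  have hmean : ∫ o, eifFn P π q o ∂(P : Measure (Obs 𝓛 𝓩)) = 0 := by
    rw [integral_congr_ae heif, integral_sub (hgrad.integrable (by norm_num))
      (integrable_const _), hgint, hψ]
    simp
  have htan := mem_tangentSpace hdens hpos hq hπm hB hε hκ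
  refine ⟨hint, ⟨hmem, hmean, fun Q hQ hQ0 s hs =>
    hasDerivAt_psiFn hdens hpos hq hπm hB hY hfin hε hκ hQ hQ0 hs, htan _ ?_⟩, htan⟩
  -- The tangent space contains every mean-zero class, so membership of the influence function
  -- reduces to its mean.
  rw [integral_congr_ae hmem.coeFn_toLp, hmean]
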